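/- Let $\varepsilon\ge 0$ and let $\mathbf G:\mathbb R\to\mathbb R^3$ be the solution (twice differentiable on $\mathbb R$) of the self-similar binormal flow $$\mathbf G-s\,\mathbf G'=2\,\mathbf G'\wedge\mathbf G'',\qquad \|\mathbf G'\|=1,$$ with initial conditions $\mathbf G'(0)=(1,0,0)$, $\mathbf G''(0)=(0,\sqrt\varepsilon,0)$. Put $$\Omega(s)=\tfrac{s^2}{4}+\varepsilon\ln\tfrac s2,\qquad \beta_1=\arg\Gamma\left(1+\tfrac{i\varepsilon}{4}\right),\qquad \beta_2=\arg\Gamma\left(\tfrac12+\tfrac{i\varepsilon}{4}\right)-\tfrac{\pi}{4}.$$ Then, for fixed $\varepsilon$, as $s\to+\infty$, $$G_1'(s)=e^{-\frac{\pi\varepsilon}{2}}+\frac{2\sqrt{\varepsilon(1-e^{-\pi\varepsilon})}}{s}\cos\left(\Omega(s)-\beta_1-\beta_2\right)+O(s^{-2}),$$ and, for each choice of sign, $$G_2'(s)\pm iG_3'(s)=\sqrt{1-e^{-\pi\varepsilon}}\,e^{\pm i(\beta_1-\beta_2)}+\frac{\sqrt\varepsilon}{s}\left[\left(1-e^{-\frac{\pi\varepsilon}{2}}\right)e^{\mp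 i\Omega(s)\pm 2i\beta_1}-\left(1+e^{-\frac{\pi\varepsilon}{2}}\right)e^{\pm i\Omega(s)\mp 2i\beta_2}\right]+O(s^{-2}).$$ Consequently the limits $\mathbf T_\pm=\lim_{s\to\pm\infty}\mathbf G'(s)$ exist and are given by $$\mathbf T_\pm=\left(e^{-\frac{\pi\varepsilon}{2}},\ \pm\sqrt{1-e^{-\pi\varepsilon}}\cos(\beta_1-\beta_2),\ \pm\sqrt{1-e^{-\pi\varepsilon}}\sin(\beta_1-\beta_2)\right);$$ in particular $\mathbf T_+\cdot\mathbf T_-=2e^{-\pi\varepsilon}-1$. -/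

import Mathlib

open Filter Topology Asymptotics

noncomputable section

/-- Euclidean three-space. -/
abbrev E3 : Type := EuclideanSpace ℝ (Fin 3)

/-- The vector product of Euclidean three-space. -/
def wedge (u v : E3) : E3 := WithLp.toLp 2 (crossProduct u.ofLp v.ofLp)

/-- `G` is a solution on the whole real line of the self-similar flow
`G - s G' = 2 G' ∧ G''`, `‖G'‖ = 1`, with the initial conditions
`G'(0) = (1, 0, 0)`, `G''(0) = (0, √ε, 0)`. -/
structure IsSelfSimilarSolution (ε : ℝ) (G : ℝ → E3) : Prop where
  differentiable : Differentiable ℝ G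
  differentiable_deriv : Differentiable ℝ (deriv G)
  flow : ∀ s : ℝ, G s - s • deriv G s = (2 : ℝ) • wedge (deriv G s) (deriv (deriv G) s)
  norm_deriv : ∀ s : ℝ, ‖deriv G s‖ = 1
  deriv_zero : deriv G 0 = !₂[1, 0, 0]
  deriv_deriv_zero : deriv (deriv G) 0 = !₂[0, √ε, 0]

/-- The phase `Ω(s) = s² / 4 + ε ln (s / 2)` (used for `s → +∞` only). -/
def phaseΩ (ε s : ℝ) : ℝ := s ^ 2 / 4 + ε * Real.log (s / 2)

/-- `β₁ = arg Γ(1 + iε/4)`. -/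
def beta₁ (ε : ℝ) : ℝ := (Complex.Gamma (1 + Complex.I * ε / 4)).arg

/-- `β₂ = arg Γ(1/2 + iε/4) - π/4`. -/
def beta₂ (ε : ℝ) : ℝ := (Complex.Gamma (1 / 2 + Complex.I * ε / 4)).arg - Real.pi / 4

end

/-!
Differentiating the flow equation shows that `G` is a curve with curvature `√ε` and torsion `s / 2`,
so every coordinate of its Frenet frame solves one and the same linear system
(`IsSelfSimilarSolution.isTangentSystem`), whose solutions are determined by their values at `0`
(`IsTangentSystem.unique`). Lifting the rotation group to `SU(2)` turns this system into
`p' = (√ε / 2) exp (i s² / 4) q`, `q' = -(√ε / 2) exp (-i s² / 4) p`, and the tangent is recovered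
as `|p|² - |q|²` (`IsSpinor.isTangentSystem`).

The spinor system is a parabolic cylinder equation and has the explicit solution
`q = √ε exp (-i s² / 4) ∫₀^∞ x ^ (i ε / 2) exp (-x² - exp (i π / 4) s x) dx` (`isSpinor_jost`).
The integral at `s = 0` is a value of `Γ`, which gives the initial data
(`jostFst_zero`, `jostSnd_zero`), and for `s → +∞` Watson's lemma gives its asymptotics, with a
constant `Γ (1 + i ε / 2)` that the duplication formula expresses through the initial data
(`I_mul_laplaceGauss_zero_zero`). Since `(-conj q, conj p)` is a solution whenever `(p, q)` is, the
asymptotics of every spinor follow from this single one, and no connection formula is needed.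
Conservation of `|p|² + |q|²` between `0` and `+∞`, together with
`|Γ (1/2 + i ε / 4)|² = π / cosh (π ε / 4)`, evaluates all moduli (`exists_jost_constants`).

The limit at `-∞` follows from the symmetry `s ↦ -s`: the first coordinate of the tangent is even
and the other two are odd.
-/

open scoped ComplexConjugate

/-! ### Laplace integrals with a Gaussian weight -/

open MeasureTheory Set in
theorem integrableOn_pow_mul_exp_neg_sq_sub (n : ℕ) {τ c : ℝ} (hτ : 0 ≤ τ) (h : 0 < τ ∨ 0 < c) :
    IntegrableOn (fun x : ℝ => x ^ n * Real.exp (-(τ * x ^ 2) - c * x)) (Ioi 0) := by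
  have hn : (-1 : ℝ) < n := neg_one_lt_zero.trans_le n.cast_nonneg
  have hmeas : AEStronglyMeasurable (fun x : ℝ => x ^ n * Real.exp (-(τ * x ^ 2) - c * x))
      (volume.restrict (Ioi 0)) := by
    apply Continuous.aestronglyMeasurable
    fun_prop
  rcases h with h | h
  -- Half of the Gaussian absorbs the linear term, by completing the square.
  · have h1 := (integrableOn_rpow_mul_exp_neg_mul_sq (half_pos h) hn).const_mul
      (Real.exp (c ^ 2 / (2 * τ)))
    refine Integrable.mono' h1 hmeas ?_
    filter_upwards [ae_restrict_mem measurableSet_Ioi] with x hx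
    have hx : 0 < x := hx
    rw [Real.norm_of_nonneg (by positivity), Real.rpow_natCast, mul_left_comm, ← Real.exp_add]
    gcongr
    have : c ^ 2 / (2 * τ) + -(τ / 2) * x ^ 2 - (-(τ * x ^ 2) - c * x) =
        (τ * x + c) ^ 2 / (2 * τ) := by field_simp; ring
    have h2 : 0 ≤ (τ * x + c) ^ 2 / (2 * τ) := by positivity
    linarith
  · have h1 := integrableOn_rpow_mul_exp_neg_mul_rpow (p := 1) hn one_pos h
    refine Integrable.mono' h1 hmeas ?_
    filter_upwards [ae_restrict_mem measurableSet_Ioi] with x hx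
    have hx : 0 < x := hx
    rw [Real.norm_of_nonneg (by positivity), Real.rpow_natCast, Real.rpow_one]
    gcongr
    have : 0 ≤ τ * x ^ 2 := by positivity
    linarith

open MeasureTheory Set in
theorem integral_pow_mul_exp_neg_mul_Ioi (n : ℕ) {c : ℝ} (hc : 0 < c) :
    ∫ x in Ioi (0 : ℝ), x ^ n * Real.exp (-(c * x)) = n.factorial / c ^ (n + 1) := by
  have h := Real.integral_rpow_mul_exp_neg_mul_Ioi (a := n + 1) (by positivity) hc
  rw [Real.Gamma_nat_eq_factorial] at h
  simp only [add_sub_cancel_right, Real.rpow_natCast] at h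
  rw [h, show ((n : ℝ) + 1) = ((n + 1 : ℕ) : ℝ) by push_cast; rfl, Real.rpow_natCast,
    one_div, inv_pow]
  ring

/-- The integrand `x ^ (n + i a) * exp (-τ x² - l x)`. -/
noncomputable def laplaceKernel (a τ : ℝ) (n : ℕ) (l : ℂ) (x : ℝ) : ℂ :=
  (x : ℂ) ^ n * (x : ℂ) ^ (Complex.I * a) * Complex.exp (-(τ * x ^ 2) - l * x)

/-- The integral `∫₀^∞ x ^ (n + i a) exp (-τ x² - l x) dx`; for `τ = 1` a parabolic cylinder
function of `l`, for `τ = 0` a power of `l`. -/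
noncomputable def laplaceGauss (a τ : ℝ) (n : ℕ) (l : ℂ) : ℂ :=
  ∫ x in Set.Ioi (0 : ℝ), laplaceKernel a τ n l x

theorem norm_cpow_I_mul {x : ℝ} (hx : 0 < x) (a : ℝ) : ‖(x : ℂ) ^ (Complex.I * a)‖ = 1 := by
  rw [Complex.norm_cpow_eq_rpow_re_of_pos hx]; simp

theorem norm_laplaceKernel (a τ : ℝ) (n : ℕ) (l : ℂ) {x : ℝ} (hx : 0 < x) :
    ‖laplaceKernel a τ n l x‖ = x ^ n * Real.exp (-(τ * x ^ 2) - l.re * x) := by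
  rw [laplaceKernel, norm_mul, norm_mul, norm_cpow_I_mul hx, norm_pow, Complex.norm_exp,
    Complex.norm_real, Real.norm_of_nonneg hx.le, mul_one]
  congr 2
  simp [← Complex.ofReal_pow]

theorem hasDerivAt_laplaceKernel (a τ : ℝ) (n : ℕ) (l : ℂ) {x : ℝ} (hx : 0 < x) :
    HasDerivAt (fun x : ℝ => laplaceKernel a τ (n + 1) l x)
      ((n + 1 + Complex.I * a) * laplaceKernel a τ n l x - 2 * τ * laplaceKernel a τ (n + 2) l x
        - l * laplaceKernel a τ (n + 1) l x) x := by
  have hx0 : (x : ℂ) ≠ 0 := by exact_mod_cast hx.ne'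
  have h1 : HasDerivAt (fun y : ℂ => y ^ (Complex.I * a))
      (Complex.I * a * (x : ℂ) ^ (Complex.I * a - 1)) (x : ℂ) :=
    (Complex.hasStrictDerivAt_cpow_const (Or.inl (by simpa using hx))).hasDerivAt
  have h2 : HasDerivAt (fun y : ℂ => -(τ * y ^ 2) - l * y) (-(τ * (2 * x)) - l) (x : ℂ) := by
    refine (((hasDerivAt_pow 2 (x : ℂ)).const_mul (τ : ℂ)).neg.sub
      ((hasDerivAt_id (x : ℂ)).const_mul l)).congr_deriv ?_
    simp
  have h3 := (((hasDerivAt_pow (n + 1) (x : ℂ)).mul h1).mul h2.cexp).comp_ofReal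
  refine h3.congr_deriv ?_
  simp only [Pi.mul_apply, laplaceKernel, Complex.cpow_sub _ _ hx0, Complex.cpow_one]
  push_cast
  field_simp
  ring_nf

open MeasureTheory Set in
theorem aestronglyMeasurable_laplaceKernel (a τ : ℝ) (n : ℕ) (l : ℂ) :
    AEStronglyMeasurable (laplaceKernel a τ n l) (volume.restrict (Ioi 0)) := by
  unfold laplaceKernel
  apply Measurable.aestronglyMeasurable
  fun_prop

open MeasureTheory Set in
theorem integrableOn_laplaceKernel (a : ℝ) {τ : ℝ} (n : ℕ) {l : ℂ} (hτ : 0 ≤ τ)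
    (h : 0 < τ ∨ 0 < l.re) : IntegrableOn (laplaceKernel a τ n l) (Ioi 0) := by
  refine Integrable.mono' (integrableOn_pow_mul_exp_neg_sq_sub n hτ h)
    (aestronglyMeasurable_laplaceKernel a τ n l) ?_
  filter_upwards [ae_restrict_mem measurableSet_Ioi] with x hx
  exact (norm_laplaceKernel a τ n l hx).le

open MeasureTheory Set in
/-- Integration by parts of `x ^ (n + 1 + i a) exp (-τ x² - l x)`. -/
theorem laplaceGauss_recurrence (a : ℝ) {τ : ℝ} (n : ℕ) {l : ℂ} (hτ : 0 ≤ τ)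
    (h : 0 < τ ∨ 0 < l.re) :
    (n + 1 + Complex.I * a) * laplaceGauss a τ n l =
      2 * τ * laplaceGauss a τ (n + 2) l + l * laplaceGauss a τ (n + 1) l := by
  have i0 := (integrableOn_laplaceKernel a n hτ h).const_mul (n + 1 + Complex.I * a)
  have i1 := (integrableOn_laplaceKernel a (n + 1) hτ h).const_mul l
  have i2 := (integrableOn_laplaceKernel a (n + 2) hτ h).const_mul (2 * τ : ℂ)
  have hd : ∀ x ∈ Ioi (0 : ℝ), HasDerivAt (fun x : ℝ => laplaceKernel a τ (n + 1) l x) _ x :=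
    fun x hx => hasDerivAt_laplaceKernel a τ n l hx
  have hz : laplaceKernel a τ (n + 1) l 0 = 0 := by simp [laplaceKernel]
  have hc : ContinuousWithinAt (fun x : ℝ => laplaceKernel a τ (n + 1) l x) (Ici 0) 0 := by
    rw [← continuousWithinAt_Ioi_iff_Ici, ContinuousWithinAt, hz,
      tendsto_zero_iff_norm_tendsto_zero]
    have h1 : Tendsto (fun x : ℝ => x ^ (n + 1) * Real.exp (-(τ * x ^ 2) - l.re * x))
        (𝓝[>] 0) (𝓝 0) := by
      have : Continuous (fun x : ℝ => x ^ (n + 1) * Real.exp (-(τ * x ^ 2) - l.re * x)) := by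
        fun_prop
      simpa using (this.tendsto 0).mono_left nhdsWithin_le_nhds
    refine h1.congr' ?_
    filter_upwards [self_mem_nhdsWithin] with x hx
    exact (norm_laplaceKernel a τ (n + 1) l hx).symm
  have ht := tendsto_zero_of_hasDerivAt_of_integrableOn_Ioi hd ((i0.sub i2).sub i1)
    (integrableOn_laplaceKernel a (n + 1) hτ h)
  have hI := integral_Ioi_of_hasDerivAt_of_tendsto hc hd ((i0.sub i2).sub i1) ht
  rw [hz] at hI
  have e1 := integral_sub (i0.sub i2) i1
  simp only [Pi.sub_apply] at e1
  rw [e1, integral_sub i0 i2] at hI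
  simp only [integral_const_mul] at hI
  simp only [laplaceGauss]
  linear_combination hI

open MeasureTheory Set in
theorem hasDerivAt_laplaceGauss (a : ℝ) {τ : ℝ} (n : ℕ) {l : ℂ} (hτ : 0 ≤ τ)
    (h : 0 < τ ∨ 0 < l.re) :
    HasDerivAt (laplaceGauss a τ n) (-laplaceGauss a τ (n + 1) l) l := by
  -- On the ball of radius `δ` the integrands share a bound, which is integrable if `Re l - δ > 0`
  -- or `τ > 0`.
  obtain ⟨δ, hδ, h'⟩ : ∃ δ : ℝ, 0 < δ ∧ (0 < τ ∨ 0 < l.re - δ) := by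
    rcases h with h | h
    · exact ⟨1, one_pos, Or.inl h⟩
    · exact ⟨l.re / 2, half_pos h, Or.inr (by linarith)⟩
  have key := hasDerivAt_integral_of_dominated_loc_of_deriv_le (𝕜 := ℂ)
    (μ := volume.restrict (Ioi (0 : ℝ))) (F := fun l x => laplaceKernel a τ n l x)
    (F' := fun l x => -laplaceKernel a τ (n + 1) l x) (x₀ := l) (s := Metric.ball l δ)
    (bound := fun x => x ^ (n + 1) * Real.exp (-(τ * x ^ 2) - (l.re - δ) * x))
    (Metric.ball_mem_nhds l hδ)
    (Eventually.of_forall fun l => aestronglyMeasurable_laplaceKernel a τ n l)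
    (integrableOn_laplaceKernel a n hτ h)
    (aestronglyMeasurable_laplaceKernel a τ (n + 1) l).neg ?_
    (integrableOn_pow_mul_exp_neg_sq_sub (n + 1) hτ h') ?_
  · have h2 := key.2
    rw [integral_neg] at h2
    exact h2
  · filter_upwards [ae_restrict_mem measurableSet_Ioi] with x hx w hw
    have hx : 0 < x := hx
    rw [norm_neg, norm_laplaceKernel a τ (n + 1) w hx]
    have h3 : |(w - l).re| < δ := (Complex.abs_re_le_norm _).trans_lt
      (by simpa [dist_eq_norm] using hw)
    rw [Complex.sub_re] at h3
    have h4 := (abs_lt.1 h3).1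
    gcongr
    linarith
  · filter_upwards with x w hw
    have h1 : HasDerivAt (fun w : ℂ => -(τ * (x : ℂ) ^ 2) - w * x) (-(x : ℂ)) w := by
      simpa using ((hasDerivAt_id w).mul_const (x : ℂ)).const_sub (-(τ * (x : ℂ) ^ 2))
    refine (h1.cexp.const_mul ((x : ℂ) ^ n * (x : ℂ) ^ (Complex.I * a))).congr_deriv ?_
    simp only [laplaceKernel]
    ring

/-- The Laplace transform of `x ^ (i a)`. Both sides satisfy `l F' = -(1 + i a) F` on the right
half-plane, and they agree at `l = 1`. -/
theorem laplaceGauss_zero_zero (a : ℝ) {l : ℂ} (hl : 0 < l.re) :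
    laplaceGauss a 0 0 l = l ^ (-(1 + Complex.I * a)) * Complex.Gamma (1 + Complex.I * a) := by
  set U : Set ℂ := {w | 0 < w.re}
  have hU : IsOpen U := isOpen_lt continuous_const Complex.continuous_re
  have hUc : Convex ℝ U := convex_halfSpace_re_gt 0
  have hne : ∀ w ∈ U, w ≠ 0 := fun w hw h0 => by
    simp [U, h0] at hw
  have hd : ∀ w ∈ U, HasDerivAt (fun w => w ^ (1 + Complex.I * a) * laplaceGauss a 0 0 w) 0 w := by
    intro w hw
    have h1 : HasDerivAt (fun y : ℂ => y ^ (1 + Complex.I * a))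
      ((1 + Complex.I * a) * w ^ (1 + Complex.I * a - 1)) w :=
      (Complex.hasStrictDerivAt_cpow_const (Or.inl hw)).hasDerivAt
    refine (h1.mul (hasDerivAt_laplaceGauss a 0 le_rfl (Or.inr hw))).congr_deriv ?_
    have h2 := laplaceGauss_recurrence a 0 le_rfl (Or.inr hw)
    have h3 : w ^ (1 + Complex.I * a) = w ^ (1 + Complex.I * a - 1) * w := by
      rw [Complex.cpow_sub _ _ (hne w hw), Complex.cpow_one, div_mul_cancel₀ _ (hne w hw)]
    push_cast at h2
    simp only [zero_add, mul_zero, zero_mul] at h2 ⊢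
    rw [h3]
    linear_combination w ^ (1 + Complex.I * a - 1) * h2
  have h1 : laplaceGauss a 0 0 1 = Complex.Gamma (1 + Complex.I * a) := by
    rw [Complex.Gamma_eq_integral (by simp), Complex.GammaIntegral, laplaceGauss]
    congr 1
    ext x
    simp [laplaceKernel, mul_comm]
  have hconst := hUc.is_const_of_fderivWithin_eq_zero (𝕜 := ℂ)
    (fun w hw => (hd w hw).differentiableAt.differentiableWithinAt)
    (fun w hw => by
      rw [fderivWithin_of_isOpen hU hw]
      exact ((hd w hw).hasFDerivAt.fderiv).trans (by ext; simp)) hl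
    (show (1 : ℂ) ∈ U by simp [U])
  simp only [Complex.one_cpow, one_mul, h1] at hconst
  rw [← hconst, ← mul_assoc, ← Complex.cpow_add _ _ (hne l hl)]
  simp

open MeasureTheory Set in
theorem laplaceGauss_one_zero (a : ℝ) (n : ℕ) :
    laplaceGauss a 1 n 0 = 1 / 2 * Complex.Gamma ((n + 1 + Complex.I * a) / 2) := by
  have h := mellin_comp_rpow (fun t : ℝ => ((Real.exp (-t) : ℝ) : ℂ)) (n + 1 + Complex.I * a) 2
  rw [← Complex.GammaIntegral_eq_mellin, Complex.ofReal_ofNat,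
    ← Complex.Gamma_eq_integral (by
      have : (0 : ℝ) ≤ n := n.cast_nonneg
      rw [show ((n : ℂ) + 1 + Complex.I * a) / 2 =
        (((n : ℝ) + 1) / 2 : ℝ) + (a / 2 : ℝ) * Complex.I by push_cast; ring]
      simp; linarith)] at h
  have h2 : ((|2|⁻¹ : ℝ)) • Complex.Gamma ((n + 1 + Complex.I * a) / 2) =
      1 / 2 * Complex.Gamma ((n + 1 + Complex.I * a) / 2) := by
    simp
  rw [← h2, ← h, mellin, laplaceGauss]
  refine setIntegral_congr_fun measurableSet_Ioi fun x hx => ?_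
  have hx : 0 < x := hx
  have hx0 : (x : ℂ) ≠ 0 := by exact_mod_cast hx.ne'
  simp only [laplaceKernel, smul_eq_mul]
  rw [show (n : ℂ) + 1 + Complex.I * a - 1 = n + Complex.I * a by ring, Complex.cpow_add _ _ hx0,
    Complex.cpow_natCast]
  simp

open MeasureTheory Set in
theorem norm_laplaceGauss_le (a : ℝ) {τ : ℝ} (n : ℕ) {l : ℂ} (hτ : 0 ≤ τ) (hl : 0 < l.re) :
    ‖laplaceGauss a τ n l‖ ≤ n.factorial / l.re ^ (n + 1) := by
  rw [← integral_pow_mul_exp_neg_mul_Ioi n hl]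
  refine norm_integral_le_of_norm_le ?_ ?_
  · simpa [IntegrableOn] using integrableOn_pow_mul_exp_neg_sq_sub n le_rfl (Or.inr hl)
  · filter_upwards [ae_restrict_mem measurableSet_Ioi] with x hx
    have hx : 0 < x := hx
    rw [norm_laplaceKernel a τ n l hx]
    gcongr
    have : 0 ≤ τ * x ^ 2 := by positivity
    linarith

open MeasureTheory Set in
/-- Watson's lemma for `laplaceGauss`: at leading order the Gaussian factor may be dropped. -/
theorem norm_laplaceGauss_one_sub_zero_le (a : ℝ) {l : ℂ} (hl : 0 < l.re) :
    ‖laplaceGauss a 1 0 l - laplaceGauss a 0 0 l‖ ≤ 2 / l.re ^ 3 := by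
  have h2 := integral_pow_mul_exp_neg_mul_Ioi 2 hl
  norm_num at h2
  rw [laplaceGauss, laplaceGauss, ← integral_sub
    (integrableOn_laplaceKernel a 0 zero_le_one (Or.inr hl))
    (integrableOn_laplaceKernel a 0 le_rfl (Or.inr hl)), ← h2]
  refine norm_integral_le_of_norm_le ?_ ?_
  · simpa [IntegrableOn] using integrableOn_pow_mul_exp_neg_sq_sub 2 le_rfl (Or.inr hl)
  · filter_upwards [ae_restrict_mem measurableSet_Ioi] with x hx
    have hx : 0 < x := hx
    have : laplaceKernel a 1 0 l x - laplaceKernel a 0 0 l x =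
        ((Real.exp (-x ^ 2) - 1 : ℝ) : ℂ) * laplaceKernel a 0 0 l x := by
      simp only [laplaceKernel]
      push_cast
      rw [show -((1 : ℂ) * x ^ 2) - l * x = -(x : ℂ) ^ 2 + (-(0 * (x : ℂ) ^ 2) - l * x) by ring,
        Complex.exp_add]
      ring
    rw [this, norm_mul, norm_laplaceKernel a 0 0 l hx, Complex.norm_real, Real.norm_eq_abs,
      abs_of_nonpos (by simp [Real.exp_le_one_iff]; positivity)]
    have h1 := Real.add_one_le_exp (-x ^ 2)
    simp only [pow_zero, one_mul, zero_mul, neg_zero, zero_sub]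
    gcongr
    linarith

/-! ### The linear system for the tangent -/

/-- The linear system satisfied by one coordinate `T` of the tangent of a curve with curvature `√ε`
and torsion `s / 2`. The second unknown is `z = √ε (N + i B)`, with `N` and `B` the same coordinate
of the normal and the binormal; unlike `N` and `B` it still makes sense when `ε = 0`. -/
structure IsTangentSystem (ε : ℝ) (T : ℝ → ℝ) (z : ℝ → ℂ) : Prop where
  hasDerivAt_fst : ∀ s, HasDerivAt T (z s).re s
  hasDerivAt_snd : ∀ s, HasDerivAt z (-(ε * T s) - Complex.I * (s / 2) * z s) s

theorem hasDerivAt_re {f : ℝ → ℂ} {f' : ℂ} {s : ℝ} (h : HasDerivAt f f' s) :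
    HasDerivAt (fun s => (f s).re) f'.re s :=
  Complex.reCLM.hasFDerivAt.comp_hasDerivAt s h

theorem hasDerivAt_im {f : ℝ → ℂ} {f' : ℂ} {s : ℝ} (h : HasDerivAt f f' s) :
    HasDerivAt (fun s => (f s).im) f'.im s :=
  Complex.imCLM.hasFDerivAt.comp_hasDerivAt s h

theorem eq_of_hasDerivAt_zero {f : ℝ → ℝ} (h : ∀ s, HasDerivAt f 0 s) (s : ℝ) : f s = f 0 :=
  is_const_of_deriv_eq_zero (fun s => (h s).differentiableAt) (fun s => (h s).deriv) s 0

namespace IsTangentSystem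

variable {ε : ℝ} {T T' : ℝ → ℝ} {z z' : ℝ → ℂ}

theorem sub (h : IsTangentSystem ε T z) (h' : IsTangentSystem ε T' z') :
    IsTangentSystem ε (fun s => T s - T' s) (fun s => z s - z' s) where
  hasDerivAt_fst s := (h.hasDerivAt_fst s).sub (h'.hasDerivAt_fst s)
  hasDerivAt_snd s := ((h.hasDerivAt_snd s).sub (h'.hasDerivAt_snd s)).congr_deriv (by
    push_cast; ring)

/-- The quantity `ε T² + |z|²` is conserved. When it vanishes, so does `z`, and `T` is constant. -/
theorem eq_zero (hε : 0 ≤ ε) (h : IsTangentSystem ε T z) (hT : T 0 = 0) (hz : z 0 = 0) (s : ℝ) :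
    T s = 0 := by
  have hE : ∀ s, ε * T s ^ 2 + ((z s).re ^ 2 + (z s).im ^ 2) = 0 := by
    intro s
    have hd : ∀ s, HasDerivAt (fun s => ε * T s ^ 2 + ((z s).re ^ 2 + (z s).im ^ 2)) 0 s := by
      intro s
      refine ((((h.hasDerivAt_fst s).pow 2).const_mul ε).add
        (((hasDerivAt_re (h.hasDerivAt_snd s)).pow 2).add
          ((hasDerivAt_im (h.hasDerivAt_snd s)).pow 2))).congr_deriv ?_
      simp
      ring
    have := eq_of_hasDerivAt_zero hd s
    simpa [hT, hz] using this
  have hre : ∀ s, (z s).re = 0 := fun s => by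
    have h1 : 0 ≤ ε * T s ^ 2 := by positivity
    have h2 := hE s
    nlinarith [sq_nonneg (z s).re, sq_nonneg (z s).im]
  rw [eq_of_hasDerivAt_zero (fun s => (h.hasDerivAt_fst s).congr_deriv (hre s)) s, hT]

theorem unique (hε : 0 ≤ ε) (h : IsTangentSystem ε T z) (h' : IsTangentSystem ε T' z')
    (hT : T 0 = T' 0) (hz : z 0 = z' 0) (s : ℝ) : T s = T' s :=
  sub_eq_zero.1 ((h.sub h').eq_zero hε (sub_eq_zero.2 hT) (sub_eq_zero.2 hz) s)

theorem neg (h : IsTangentSystem ε T z) :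
    IsTangentSystem ε (fun s => -T s) (fun s => -z s) where
  hasDerivAt_fst s := (h.hasDerivAt_fst s).neg
  hasDerivAt_snd s := (h.hasDerivAt_snd s).neg.congr_deriv (by push_cast; ring)

/-- The symmetry `s ↦ -s` of the system. -/
theorem reflect (h : IsTangentSystem ε T z) :
    IsTangentSystem ε (fun s => T (-s)) (fun s => -z (-s)) where
  hasDerivAt_fst s := ((h.hasDerivAt_fst (-s)).scomp s (hasDerivAt_neg s)).congr_deriv (by simp)
  hasDerivAt_snd s := ((h.hasDerivAt_snd (-s)).scomp s (hasDerivAt_neg s)).neg.congr_deriv (by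
    push_cast
    rw [neg_one_smul]
    ring)

theorem even_of_snd_eq_zero (hε : 0 ≤ ε) (h : IsTangentSystem ε T z) (hz : z 0 = 0) (s : ℝ) :
    T (-s) = T s :=
  h.reflect.unique hε h (by simp) (by simp [hz]) s

theorem odd_of_fst_eq_zero (hε : 0 ≤ ε) (h : IsTangentSystem ε T z) (hT : T 0 = 0) (s : ℝ) :
    T (-s) = -T s :=
  h.reflect.unique hε h.neg (by simp [hT]) (by simp) s

end IsTangentSystem

theorem wedge_apply (u v : E3) (i : Fin 3) :
    wedge u v i = u (i + 1) * v (i + 2) - u (i + 2) * v (i + 1) := by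
  simp only [wedge, cross_apply]
  fin_cases i <;> rfl

theorem hasDerivAt_apply {f : ℝ → E3} {f' : E3} {s : ℝ} (h : HasDerivAt f f' s) (i : Fin 3) :
    HasDerivAt (fun s => f s i) (f' i) s :=
  (EuclideanSpace.proj (𝕜 := ℝ) i).hasFDerivAt.comp_hasDerivAt s h

theorem fin_three_sum_eq {R : Type*} [AddCommMonoid R] (f : Fin 3 → R) (i : Fin 3) :
    ∑ j, f j = f i + f (i + 1) + f (i + 2) := by
  rw [Fin.sum_univ_three]
  fin_cases i
  · rfl
  · change f 0 + f 1 + f 2 = f 1 + f 2 + f 0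
    abel
  · change f 0 + f 1 + f 2 = f 2 + f 0 + f 1
    abel

namespace IsSelfSimilarSolution

variable {ε : ℝ} {G : ℝ → E3}

theorem normal_zero (hG : IsSelfSimilarSolution ε G) (i : Fin 3) :
    (G 0 i - 0 * deriv G 0 i) / 2 = (!₂[0, 0, √ε] : E3) i := by
  have h := congrArg (fun v : E3 => v i) (hG.flow 0)
  simp only [PiLp.sub_apply, PiLp.smul_apply, smul_eq_mul, wedge_apply, hG.deriv_zero,
    hG.deriv_deriv_zero] at h
  rw [hG.deriv_zero, h]
  match i with
  | 0 => simp
  | 1 => change 2 * ((0 : ℝ) * 0 - 1 * 0) / 2 = 0; norm_num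
  | 2 => change 2 * ((1 : ℝ) * √ε - 0 * 0) / 2 = √ε; ring

/-- Each coordinate of `G'` satisfies the linear tangent system, the binormal vector
`√ε B = G' ∧ G''` being `(G - s G') / 2`. The flow equation yields `G'' = (G' ∧ G'') ∧ G'`, which
provides the third derivative and the conservation of `|G''|² = ε`. -/
theorem isTangentSystem (hε : 0 ≤ ε) (hG : IsSelfSimilarSolution ε G) (i : Fin 3) :
    IsTangentSystem ε (fun s => deriv G s i)
      (fun s => ((deriv (deriv G) s i : ℝ) : ℂ) +
        Complex.I * (((G s i - s * deriv G s i) / 2 : ℝ) : ℂ)) := by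
  set M : Fin 3 → ℝ → ℝ := fun i s => (G s i - s * deriv G s i) / 2 with hM
  set T : Fin 3 → ℝ → ℝ := fun i s => deriv G s i with hT
  set U : Fin 3 → ℝ → ℝ := fun i s => deriv (deriv G) s i with hU
  have dT : ∀ i s, HasDerivAt (T i) (U i s) s := fun i s =>
    hasDerivAt_apply (hG.differentiable_deriv s).hasDerivAt i
  have dM : ∀ i s, HasDerivAt (M i) (-(s / 2) * U i s) s := fun i s => by
    have h1 := hasDerivAt_apply (hG.differentiable s).hasDerivAt i
    refine ((h1.sub ((hasDerivAt_id s).mul (dT i s))).div_const 2).congr_deriv ?_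
    simp only [hT, id]
    ring
  have eM : ∀ i s, M i s = T (i + 1) s * U (i + 2) s - T (i + 2) s * U (i + 1) s := fun i s => by
    have h := congrArg (fun v : E3 => v i) (hG.flow s)
    simp only [PiLp.sub_apply, PiLp.smul_apply, smul_eq_mul, wedge_apply] at h
    simp only [hM, hT, hU]
    linarith
  have nT : ∀ i s, T i s ^ 2 + T (i + 1) s ^ 2 + T (i + 2) s ^ 2 = 1 := fun i s => by
    have h := EuclideanSpace.norm_sq_eq (deriv G s)
    rw [hG.norm_deriv, fin_three_sum_eq _ i] at h
    simpa [Real.norm_eq_abs, sq_abs, hT] using h.symm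
  have oT : ∀ i s, T i s * U i s + T (i + 1) s * U (i + 1) s + T (i + 2) s * U (i + 2) s = 0 := by
    intro i s
    have h1 := ((((dT i s).pow 2).add ((dT (i + 1) s).pow 2)).add ((dT (i + 2) s).pow 2))
    have h2 : (T i ^ 2 + T (i + 1) ^ 2 + T (i + 2) ^ 2) = fun _ => (1 : ℝ) := by
      ext s
      simpa using nT i s
    rw [h2] at h1
    have h3 := h1.unique (hasDerivAt_const s 1)
    norm_num at h3
    linarith
  have e12 : ∀ i : Fin 3, i + 1 + 1 = i + 2 := by decide
  have e13 : ∀ i : Fin 3, i + 1 + 2 = i := by decide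
  have e21 : ∀ i : Fin 3, i + 2 + 1 = i := by decide
  have e22 : ∀ i : Fin 3, i + 2 + 2 = i + 1 := by decide
  have eU : ∀ i s, U i s = M (i + 1) s * T (i + 2) s - M (i + 2) s * T (i + 1) s := fun i s => by
    rw [eM (i + 1), eM (i + 2), e12, e13, e21, e22]
    linear_combination (-U i s) * nT i s + T i s * oT i s
  have nM : ∀ i s, M i s ^ 2 + M (i + 1) s ^ 2 + M (i + 2) s ^ 2 =
      U i s ^ 2 + U (i + 1) s ^ 2 + U (i + 2) s ^ 2 := fun i s => by
    rw [eM i, eM (i + 1), eM (i + 2), e12, e13, e21, e22]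
    linear_combination (U i s ^ 2 + U (i + 1) s ^ 2 + U (i + 2) s ^ 2) * nT i s -
      (T i s * U i s + T (i + 1) s * U (i + 1) s + T (i + 2) s * U (i + 2) s) * oT i s
  have cM : ∀ i s, M i s ^ 2 + M (i + 1) s ^ 2 + M (i + 2) s ^ 2 = ε := by
    intro i s
    have hd : ∀ s, HasDerivAt (fun s => M i s ^ 2 + M (i + 1) s ^ 2 + M (i + 2) s ^ 2) 0 s := by
      intro s
      refine ((((dM i s).pow 2).add ((dM (i + 1) s).pow 2)).add
        ((dM (i + 2) s).pow 2)).congr_deriv ?_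
      norm_num
      rw [eM i, eM (i + 1), eM (i + 2), e12, e13, e21, e22]
      ring
    rw [eq_of_hasDerivAt_zero hd s]
    have h3 := fin_three_sum_eq (fun j => M j 0 ^ 2) i
    rw [← h3, Fin.sum_univ_three]
    simp only [hM, hG.normal_zero]
    simp [Real.sq_sqrt hε]
  have dU : ∀ i s, HasDerivAt (U i) (-(ε * T i s) + s / 2 * M i s) s := by
    intro i s
    have h1 := ((dM (i + 1) s).mul (dT (i + 2) s)).sub ((dM (i + 2) s).mul (dT (i + 1) s))
    have h2 : U i = M (i + 1) * T (i + 2) - M (i + 2) * T (i + 1) := by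
      ext s
      exact eU i s
    rw [← h2] at h1
    refine h1.congr_deriv ?_
    rw [← cM i s, nM i s, eM i, eM (i + 1), eM (i + 2), e12, e13, e21, e22]
    linear_combination U i s * oT i s
  refine ⟨fun s => ?_, fun s => ?_⟩
  · refine (dT i s).congr_deriv ?_
    simp [hU]
  · refine ((dU i s).ofReal_comp.add ((dM i s).ofReal_comp.const_mul Complex.I)).congr_deriv ?_
    simp only [hM, hT, hU]
    push_cast
    linear_combination (s / 2 * ((G s i - s * deriv G s i) / 2) : ℂ) * Complex.I_mul_I

end IsSelfSimilarSolution

/-! ### Spinors -/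

/-- The Fresnel phase `exp (i s² / 4)`. -/
noncomputable def quadPhase (s : ℝ) : ℂ := Complex.exp (Complex.I * (s ^ 2 / 4))

theorem conj_quadPhase (s : ℝ) : conj (quadPhase s) = Complex.exp (-(Complex.I * (s ^ 2 / 4))) := by
  rw [quadPhase, ← Complex.exp_conj]
  simp [Complex.conj_ofNat]

theorem quadPhase_mul_conj (s : ℝ) : quadPhase s * conj (quadPhase s) = 1 := by
  rw [conj_quadPhase, quadPhase, ← Complex.exp_add]
  simp

theorem norm_quadPhase (s : ℝ) : ‖quadPhase s‖ = 1 := by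
  rw [quadPhase, show Complex.I * ((s : ℂ) ^ 2 / 4) = ((s ^ 2 / 4 : ℝ) : ℂ) * Complex.I by
    push_cast; ring]
  exact Complex.norm_exp_ofReal_mul_I _

theorem hasDerivAt_conj_quadPhase (s : ℝ) :
    HasDerivAt (fun s => conj (quadPhase s)) (-(Complex.I * (s / 2)) * conj (quadPhase s)) s := by
  simp only [conj_quadPhase]
  have h1 : HasDerivAt (fun x : ℂ => -(Complex.I * (x ^ 2 / 4))) (-(Complex.I * (s / 2))) (s : ℂ) :=
    ((((hasDerivAt_pow 2 (s : ℂ)).div_const 4).const_mul Complex.I).neg).congr_deriv (by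
      norm_num; ring)
  exact h1.cexp.comp_ofReal.congr_deriv (by ring)

theorem hasDerivAt_conj {f : ℝ → ℂ} {f' : ℂ} {s : ℝ} (h : HasDerivAt f f' s) :
    HasDerivAt (fun s => conj (f s)) (conj f') s :=
  h.star

/-- The lift to `SU(2)` of the Frenet equations of a curve with curvature `√ε` and torsion `s / 2`,
with the torsion removed by the phase `exp (∓ i s² / 8)` on the two components. -/
structure IsSpinor (ε : ℝ) (p q : ℝ → ℂ) : Prop where
  hasDerivAt_fst : ∀ s, HasDerivAt p (√ε / 2 * quadPhase s * q s) s
  hasDerivAt_snd : ∀ s, HasDerivAt q (-(√ε / 2) * conj (quadPhase s) * p s) s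

namespace IsSpinor

variable {ε : ℝ} {p q p' q' : ℝ → ℂ}

/-- The quaternionic structure of `SU(2)`: a second solution, obtained from the first. -/
theorem conj_swap (h : IsSpinor ε p q) :
    IsSpinor ε (fun s => -conj (q s)) (fun s => conj (p s)) where
  hasDerivAt_fst s := (hasDerivAt_conj (h.hasDerivAt_snd s)).neg.congr_deriv (by
    simp [Complex.conj_ofNat])
  hasDerivAt_snd s := (hasDerivAt_conj (h.hasDerivAt_fst s)).congr_deriv (by
    simp [Complex.conj_ofNat])

theorem linearCombination (h : IsSpinor ε p q) (h' : IsSpinor ε p' q') (α β : ℂ) :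
    IsSpinor ε (fun s => α * p s + β * p' s) (fun s => α * q s + β * q' s) where
  hasDerivAt_fst s := (((h.hasDerivAt_fst s).const_mul α).add
    ((h'.hasDerivAt_fst s).const_mul β)).congr_deriv (by ring)
  hasDerivAt_snd s := (((h.hasDerivAt_snd s).const_mul α).add
    ((h'.hasDerivAt_snd s).const_mul β)).congr_deriv (by ring)

theorem normSq_add_normSq (h : IsSpinor ε p q) (s : ℝ) :
    Complex.normSq (p s) + Complex.normSq (q s) =
      Complex.normSq (p 0) + Complex.normSq (q 0) := by
  have hd : ∀ s, HasDerivAt (fun s => (p s * conj (p s) + q s * conj (q s)).re) 0 s := by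
    intro s
    refine (hasDerivAt_re (((h.hasDerivAt_fst s).mul
      (hasDerivAt_conj (h.hasDerivAt_fst s))).add ((h.hasDerivAt_snd s).mul
      (hasDerivAt_conj (h.hasDerivAt_snd s))))).congr_deriv ?_
    simp [Complex.conj_ofNat]
    ring
  have := eq_of_hasDerivAt_zero hd s
  simpa only [Complex.mul_conj, Complex.add_re, Complex.ofReal_re] using this

/-- The Hopf map sends spinors to solutions of the tangent system. -/
theorem isTangentSystem (hε : 0 ≤ ε) (h : IsSpinor ε p q) (c : ℝ) :
    IsTangentSystem ε (fun s => c * (Complex.normSq (p s) - Complex.normSq (q s)))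
      (fun s => 2 * c * √ε * (conj (quadPhase s) * (p s * conj (q s)))) := by
  refine ⟨fun s => ?_, fun s => ?_⟩
  · have h1 := (hasDerivAt_re (((h.hasDerivAt_fst s).mul
      (hasDerivAt_conj (h.hasDerivAt_fst s))).sub ((h.hasDerivAt_snd s).mul
      (hasDerivAt_conj (h.hasDerivAt_snd s))))).const_mul c
    simp only [Pi.sub_apply, Pi.mul_apply, Complex.mul_conj, ← Complex.ofReal_sub,
      Complex.ofReal_re] at h1
    refine h1.congr_deriv ?_
    simp [Complex.conj_ofNat]
    ring
  · refine (((hasDerivAt_conj_quadPhase s).mul ((h.hasDerivAt_fst s).mul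
      (hasDerivAt_conj (h.hasDerivAt_snd s)))).const_mul (2 * c * √ε : ℂ)).congr_deriv ?_
    have hk : (√ε : ℂ) * √ε = ε := by
      rw [← Complex.ofReal_mul, Real.mul_self_sqrt hε]
    have hq := quadPhase_mul_conj s
    simp only [Pi.mul_apply, map_mul, map_neg, map_div₀, Complex.conj_conj, Complex.conj_ofReal,
      map_ofNat]
    push_cast
    rw [← Complex.mul_conj, ← Complex.mul_conj]
    linear_combination ((√ε : ℂ) * √ε * c * (q s * conj (q s) - p s * conj (p s))) * hq +
      c * (q s * conj (q s) - p s * conj (p s)) * hk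

end IsSpinor

/-! ### An explicit spinor -/

/-- The eighth root of unity `exp (i π / 4)`. -/
noncomputable def zeta8 : ℂ := Complex.exp (Complex.I * (Real.pi / 4))

theorem zeta8_sq : zeta8 * zeta8 = Complex.I := by
  rw [zeta8, ← Complex.exp_add, show Complex.I * ((Real.pi : ℂ) / 4) + Complex.I * (Real.pi / 4) =
    Real.pi / 2 * Complex.I by ring, Complex.exp_pi_div_two_mul_I]

theorem zeta8_re_pos : 0 < zeta8.re := by
  rw [zeta8, show Complex.I * ((Real.pi : ℂ) / 4) = ((Real.pi / 4 : ℝ) : ℂ) * Complex.I by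
    push_cast; ring, Complex.exp_ofReal_mul_I_re, Real.cos_pi_div_four]
  positivity

theorem norm_zeta8 : ‖zeta8‖ = 1 := by
  rw [zeta8, show Complex.I * ((Real.pi : ℂ) / 4) = ((Real.pi / 4 : ℝ) : ℂ) * Complex.I by
    push_cast; ring, Complex.norm_exp_ofReal_mul_I]

/-- The second component of the spinor whose first component approaches, as `s → +∞`, a multiple of
the pure phase `exp (-i (ε / 2) log s)` and whose second component tends to zero. The direction
`zeta8` makes the Laplace integral converge absolutely and decay for `s > 0`. -/
noncomputable def jostSnd (ε s : ℝ) : ℂ :=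
  √ε * (conj (quadPhase s) * laplaceGauss (ε / 2) 1 0 (zeta8 * s))

/-- The first component of the same spinor. -/
noncomputable def jostFst (ε s : ℝ) : ℂ :=
  2 * zeta8 * laplaceGauss (ε / 2) 1 1 (zeta8 * s) +
    Complex.I * s * laplaceGauss (ε / 2) 1 0 (zeta8 * s)

theorem hasDerivAt_laplaceGauss_zeta8 (a : ℝ) (n : ℕ) (s : ℝ) :
    HasDerivAt (fun s : ℝ => laplaceGauss a 1 n (zeta8 * s))
      (-(zeta8 * laplaceGauss a 1 (n + 1) (zeta8 * s))) s := by
  have h1 : HasDerivAt (fun w : ℂ => zeta8 * w) zeta8 (s : ℂ) := by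
    simpa using (hasDerivAt_id (s : ℂ)).const_mul zeta8
  have h2 := hasDerivAt_laplaceGauss a n (l := zeta8 * s) zero_le_one (Or.inl one_pos)
  exact (h2.comp (s : ℂ) h1).comp_ofReal.congr_deriv (by ring)

/-- Differentiation of the Laplace integrals raises the power of `x`; the recurrence, in which
`zeta8 ^ 2 = i`, closes the system. -/
theorem isSpinor_jost {ε : ℝ} (hε : 0 ≤ ε) : IsSpinor ε (jostFst ε) (jostSnd ε) := by
  have hk : (√ε : ℂ) * √ε = ε := by
    rw [← Complex.ofReal_mul, Real.mul_self_sqrt hε]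
  have hI := Complex.I_mul_I
  refine ⟨fun s => ?_, fun s => ?_⟩
  · have h0 := hasDerivAt_laplaceGauss_zeta8 (ε / 2) 0 s
    have h1 := hasDerivAt_laplaceGauss_zeta8 (ε / 2) 1 s
    have hs : HasDerivAt (fun s : ℝ => Complex.I * (s : ℂ)) Complex.I s := by
      simpa using ((hasDerivAt_id (s : ℂ)).const_mul Complex.I).comp_ofReal
    refine ((h1.const_mul (2 * zeta8)).add (hs.mul h0)).congr_deriv ?_
    have hr := laplaceGauss_recurrence (ε / 2) 0 (l := zeta8 * s) zero_le_one (Or.inl one_pos)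
    have hq := quadPhase_mul_conj s
    push_cast at hr
    simp only [zero_add, mul_one] at hr
    simp only [jostSnd, zero_add, one_add_one_eq_two]
    linear_combination Complex.I * hr - 2 * laplaceGauss (ε / 2) 1 2 (zeta8 * s) * zeta8_sq -
      ε / 2 * laplaceGauss (ε / 2) 1 0 (zeta8 * s) * (hI + hq) -
      quadPhase s * conj (quadPhase s) / 2 * laplaceGauss (ε / 2) 1 0 (zeta8 * s) * hk
  · have h0 := hasDerivAt_laplaceGauss_zeta8 (ε / 2) 0 s
    refine (((hasDerivAt_conj_quadPhase s).mul h0).const_mul (√ε : ℂ)).congr_deriv ?_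
    simp only [jostFst, zero_add]
    ring

/-! ### Values at zero and asymptotics of the explicit spinor -/

theorem zeta8_ne_zero : zeta8 ≠ 0 := Complex.exp_ne_zero _

theorem conj_zeta8_sq : conj zeta8 * conj zeta8 = -Complex.I := by
  rw [← map_mul, zeta8_sq, Complex.conj_I]

theorem zeta8_mul_conj : zeta8 * conj zeta8 = 1 := by
  rw [Complex.mul_conj, Complex.normSq_eq_norm_sq, norm_zeta8]; simp

theorem log_zeta8 : Complex.log zeta8 = Complex.I * (Real.pi / 4) := by
  have h : (Complex.I * ((Real.pi : ℂ) / 4)).im = Real.pi / 4 := by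
    rw [show Complex.I * ((Real.pi : ℂ) / 4) = ((Real.pi / 4 : ℝ) : ℂ) * Complex.I by
      push_cast; ring, Complex.im_ofReal_mul]
    simp
  rw [zeta8, Complex.log_exp] <;> rw [h] <;> linarith [Real.pi_pos]

theorem zeta8_mul_re (s : ℝ) : (zeta8 * (s : ℂ)).re = zeta8.re * s := by simp

theorem jostFst_zero (ε : ℝ) : jostFst ε 0 = zeta8 * Complex.Gamma (1 + Complex.I * ε / 4) := by
  simp only [jostFst, Complex.ofReal_zero, mul_zero, zero_mul, add_zero, laplaceGauss_one_zero]
  rw [show (((1 : ℕ) : ℂ) + 1 + Complex.I * ((ε / 2 : ℝ) : ℂ)) / 2 = 1 + Complex.I * ε / 4 by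
    push_cast; ring]
  ring

theorem jostSnd_zero (ε : ℝ) :
    jostSnd ε 0 = √ε / 2 * Complex.Gamma (1 / 2 + Complex.I * ε / 4) := by
  simp only [jostSnd, Complex.ofReal_zero, mul_zero, laplaceGauss_one_zero, quadPhase]
  rw [show (((0 : ℕ) : ℂ) + 1 + Complex.I * ((ε / 2 : ℝ) : ℂ)) / 2 = 1 / 2 + Complex.I * ε / 4 by
    push_cast; ring]
  simp
  ring

theorem normSq_jostFst_zero (ε : ℝ) : Complex.normSq (jostFst ε 0) =
    ‖Complex.Gamma (1 + Complex.I * ε / 4)‖ ^ 2 := by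
  rw [jostFst_zero, Complex.normSq_eq_norm_sq, norm_mul, norm_zeta8, one_mul]

theorem normSq_jostSnd_zero {ε : ℝ} (hε : 0 ≤ ε) : Complex.normSq (jostSnd ε 0) =
    ε / 4 * ‖Complex.Gamma (1 / 2 + Complex.I * ε / 4)‖ ^ 2 := by
  rw [jostSnd_zero, Complex.normSq_eq_norm_sq, norm_mul, norm_div, Complex.norm_real,
    Real.norm_of_nonneg (Real.sqrt_nonneg _), mul_pow, div_pow, Real.sq_sqrt hε]
  norm_num

/-- The leading term of `jostFst ε s` as `s → +∞`. -/
noncomputable def jostLead (ε s : ℝ) : ℂ :=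
  zeta8 * Real.exp (Real.pi * ε / 8) * (Complex.Gamma (1 + Complex.I * ε / 4) *
    Complex.Gamma (1 / 2 + Complex.I * ε / 4) / √Real.pi) *
    Complex.exp (-(Complex.I * (ε / 2 * Real.log (s / 2))))

/-- The duplication formula turns `Γ (1 + i ε / 2)` into the two Gamma values that occur in the
initial data. -/
theorem I_mul_laplaceGauss_zero_zero (ε : ℝ) {s : ℝ} (hs : 0 < s) :
    Complex.I * s * laplaceGauss (ε / 2) 0 0 (zeta8 * s) = jostLead ε s := by
  have hs0 : (s : ℂ) ≠ 0 := by exact_mod_cast hs.ne'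
  have hpi : ((√Real.pi : ℝ) : ℂ) ≠ 0 := by
    exact_mod_cast (Real.sqrt_pos.2 Real.pi_pos).ne'
  have hdup := Complex.Gamma_mul_Gamma_add_half (1 / 2 + Complex.I * ε / 4)
  rw [show (1 / 2 + Complex.I * (ε : ℂ) / 4) + 1 / 2 = 1 + Complex.I * ε / 4 by ring,
    show 2 * (1 / 2 + Complex.I * (ε : ℂ) / 4) = 1 + Complex.I * (ε / 2) by ring,
    show (1 : ℂ) - (1 + Complex.I * (ε / 2)) = -(Complex.I * (ε / 2)) by ring,
    Complex.cpow_def_of_ne_zero two_ne_zero] at hdup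
  rw [laplaceGauss_zero_zero _ (by rw [zeta8_mul_re]; exact mul_pos zeta8_re_pos hs),
    Complex.cpow_def_of_ne_zero (mul_ne_zero zeta8_ne_zero hs0), mul_comm zeta8,
    Complex.log_ofReal_mul hs zeta8_ne_zero, log_zeta8, jostLead, Real.log_div hs.ne' two_ne_zero,
    mul_comm (Complex.Gamma (1 + Complex.I * ε / 4)), hdup]
  push_cast
  have hl2 : Complex.log 2 = (Real.log 2 : ℂ) := by
    rw [Complex.ofReal_log zero_le_two]; simp
  have e1 : Complex.exp ((Real.log s + Complex.I * (Real.pi / 4)) *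
      (-(1 + Complex.I * (ε / 2)))) * (s * zeta8) = Complex.exp (Real.pi * ε / 8) *
        (Complex.exp (Complex.log 2 * (-(Complex.I * (ε / 2)))) *
        Complex.exp (-(Complex.I * (ε / 2 * (Real.log s - Real.log 2))))) := by
    have : (s : ℂ) = Complex.exp (Real.log s) := by
      rw [← Complex.ofReal_exp, Real.exp_log hs]
    rw [hl2]
    rw [this]
    rw [zeta8, ← Complex.exp_add, ← Complex.exp_add, ← Complex.exp_add, ← Complex.exp_add]
    congr 1
    linear_combination (-(Real.pi * ε / 8) : ℂ) * Complex.I_mul_I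
  rw [mul_div_cancel_right₀ _ hpi]
  linear_combination zeta8 * Complex.Gamma (1 + Complex.I * (ε / 2)) * e1 -
    s * (Complex.exp ((Real.log s + Complex.I * (Real.pi / 4)) * (-(1 + Complex.I * (ε / 2)))) *
      Complex.Gamma (1 + Complex.I * (ε / 2))) * zeta8_sq

theorem norm_jostLead (ε s : ℝ) : ‖jostLead ε s‖ =
    Real.exp (Real.pi * ε / 8) * (‖Complex.Gamma (1 + Complex.I * ε / 4)‖ *
      ‖Complex.Gamma (1 / 2 + Complex.I * ε / 4)‖ / √Real.pi) := by
  rw [jostLead, show -(Complex.I * ((ε : ℂ) / 2 * Real.log (s / 2))) =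
    ((-(ε / 2 * Real.log (s / 2)) : ℝ) : ℂ) * Complex.I by push_cast; ring]
  simp only [norm_mul, norm_div, norm_zeta8, Complex.norm_exp_ofReal_mul_I, Complex.norm_real,
    Real.norm_of_nonneg (Real.exp_pos _).le, Real.norm_of_nonneg (Real.sqrt_nonneg _)]
  ring

theorem norm_laplaceGauss_zeta8_sub_le (ε : ℝ) {s : ℝ} (hs : 0 < s) :
    ‖laplaceGauss (ε / 2) 1 0 (zeta8 * s) - laplaceGauss (ε / 2) 0 0 (zeta8 * s)‖ ≤
      2 / zeta8.re ^ 3 / s ^ 3 := by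
  have hre : 0 < (zeta8 * (s : ℂ)).re := by rw [zeta8_mul_re]; exact mul_pos zeta8_re_pos hs
  refine (norm_laplaceGauss_one_sub_zero_le (ε / 2) hre).trans_eq ?_
  rw [zeta8_mul_re, mul_pow, div_div]

theorem jostFst_sub_jostLead_isBigO (ε : ℝ) :
    (fun s => jostFst ε s - jostLead ε s) =O[atTop] fun s : ℝ => (s ^ 2)⁻¹ := by
  refine IsBigO.of_bound (2 / zeta8.re ^ 2 + 2 / zeta8.re ^ 3) ?_
  filter_upwards [eventually_gt_atTop 0] with s hs
  have hre : 0 < (zeta8 * (s : ℂ)).re := by rw [zeta8_mul_re]; exact mul_pos zeta8_re_pos hs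
  have h1 := norm_laplaceGauss_le (ε / 2) 1 zero_le_one hre
  have h2 := norm_laplaceGauss_zeta8_sub_le ε hs
  have hz := zeta8_re_pos
  rw [zeta8_mul_re, Nat.factorial_one, Nat.cast_one, one_add_one_eq_two] at h1
  have h3 : jostFst ε s - jostLead ε s = 2 * zeta8 * laplaceGauss (ε / 2) 1 1 (zeta8 * s) +
      Complex.I * s * (laplaceGauss (ε / 2) 1 0 (zeta8 * s) -
        laplaceGauss (ε / 2) 0 0 (zeta8 * s)) := by
    rw [← I_mul_laplaceGauss_zero_zero ε hs, jostFst]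
    ring
  rw [h3, Real.norm_of_nonneg (by positivity)]
  calc _ ≤ 2 * ‖laplaceGauss (ε / 2) 1 1 (zeta8 * s)‖ +
      s * ‖laplaceGauss (ε / 2) 1 0 (zeta8 * s) - laplaceGauss (ε / 2) 0 0 (zeta8 * s)‖ := by
        refine (norm_add_le _ _).trans_eq ?_
        simp [norm_zeta8, abs_of_pos hs]
    _ ≤ 2 * (1 / (zeta8.re * s) ^ 2) + s * (2 / zeta8.re ^ 3 / s ^ 3) := by gcongr
    _ = _ := by field_simp

/-- The leading term of `jostSnd ε s` as `s → +∞`. -/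
noncomputable def jostSndLead (ε s : ℝ) : ℂ :=
  -(Complex.I * √ε / s) * (conj (quadPhase s) * jostLead ε s)

theorem jostSnd_sub_jostSndLead_isBigO (ε : ℝ) :
    (fun s => jostSnd ε s - jostSndLead ε s) =O[atTop] fun s : ℝ => (s ^ 2)⁻¹ := by
  refine IsBigO.of_bound (√ε * (2 / zeta8.re ^ 3)) ?_
  filter_upwards [eventually_ge_atTop 1] with s hs
  have hs0 : 0 < s := by linarith
  have hs1 : (s : ℂ) ≠ 0 := by exact_mod_cast hs0.ne'
  have h2 := norm_laplaceGauss_zeta8_sub_le ε hs0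
  have hz := zeta8_re_pos
  have h3 : jostSnd ε s - jostSndLead ε s = √ε * (conj (quadPhase s) *
      (laplaceGauss (ε / 2) 1 0 (zeta8 * s) - laplaceGauss (ε / 2) 0 0 (zeta8 * s))) := by
    rw [jostSnd, jostSndLead, ← I_mul_laplaceGauss_zero_zero ε hs0]
    field_simp
    linear_combination (√ε * conj (quadPhase s) * laplaceGauss (ε / 2) 0 0 (zeta8 * s)) *
      Complex.I_mul_I
  rw [h3, Real.norm_of_nonneg (by positivity), norm_mul, norm_mul, Complex.norm_conj,
    norm_quadPhase, one_mul, Complex.norm_real, Real.norm_of_nonneg (Real.sqrt_nonneg _), mul_assoc,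
    ← div_eq_mul_inv]
  refine mul_le_mul_of_nonneg_left (h2.trans ?_) (Real.sqrt_nonneg _)
  gcongr
  norm_num

theorem jostLead_isBigO_one (ε : ℝ) : jostLead ε =O[atTop] fun _ : ℝ => (1 : ℝ) :=
  IsBigO.of_bound _ (Eventually.of_forall fun s => by
    rw [norm_jostLead, norm_one, mul_one])

theorem inv_sq_isBigO_inv : (fun s : ℝ => (s ^ 2)⁻¹) =O[atTop] fun s : ℝ => s⁻¹ := by
  refine IsBigO.of_bound 1 ?_
  filter_upwards [eventually_ge_atTop 1] with s hs
  have hs0 : 0 < s := by linarith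
  rw [Real.norm_of_nonneg (by positivity), Real.norm_of_nonneg (by positivity), one_mul]
  gcongr
  nlinarith

theorem inv_isBigO_one : (fun s : ℝ => s⁻¹) =O[atTop] fun _ : ℝ => (1 : ℝ) :=
  tendsto_inv_atTop_zero.isBigO_one ℝ

theorem jostSndLead_isBigO (ε : ℝ) : jostSndLead ε =O[atTop] fun s : ℝ => s⁻¹ := by
  have h : jostSndLead ε = fun s => ((s⁻¹ : ℝ) : ℂ) *
      (-(Complex.I * √ε) * conj (quadPhase s) * jostLead ε s) := by
    ext s
    rw [jostSndLead]
    push_cast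
    ring
  have h1 : (fun s : ℝ => ((s⁻¹ : ℝ) : ℂ)) =O[atTop] fun s : ℝ => s⁻¹ :=
    IsBigO.of_bound 1 (Eventually.of_forall fun s => by simp)
  have h2 : (fun s => -(Complex.I * √ε) * conj (quadPhase s)) =O[atTop] fun _ : ℝ => (1 : ℝ) :=
    IsBigO.of_bound √ε (Eventually.of_forall fun s => by
      simp [norm_quadPhase, abs_of_nonneg (Real.sqrt_nonneg ε)])
  rw [h]
  simpa using h1.mul (h2.mul (jostLead_isBigO_one ε))

theorem jostSnd_isBigO (ε : ℝ) : jostSnd ε =O[atTop] fun s : ℝ => s⁻¹ := by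
  have := ((jostSnd_sub_jostSndLead_isBigO ε).trans inv_sq_isBigO_inv).add (jostSndLead_isBigO ε)
  simpa using this

theorem jostFst_isBigO_one (ε : ℝ) : jostFst ε =O[atTop] fun _ : ℝ => (1 : ℝ) := by
  have := (((jostFst_sub_jostLead_isBigO ε).trans inv_sq_isBigO_inv).trans inv_isBigO_one).add
    (jostLead_isBigO_one ε)
  simpa using this

theorem jostFst_mul_jostSnd_isBigO (ε : ℝ) :
    (fun s => jostFst ε s * jostSnd ε s - jostLead ε s * jostSndLead ε s) =O[atTop]
      fun s : ℝ => (s ^ 2)⁻¹ := by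
  have h1 := (jostFst_isBigO_one ε).mul (jostSnd_sub_jostSndLead_isBigO ε)
  have h2 := (jostFst_sub_jostLead_isBigO ε).mul ((jostSndLead_isBigO ε).trans inv_isBigO_one)
  simp only [one_mul, mul_one] at h1 h2
  refine (h1.add h2).congr_left fun s => ?_
  ring

theorem normSq_jostSnd_isBigO (ε : ℝ) :
    (fun s => Complex.normSq (jostSnd ε s)) =O[atTop] fun s : ℝ => (s ^ 2)⁻¹ := by
  have h := (jostSnd_isBigO ε).norm_left.pow 2
  simpa only [Complex.normSq_eq_norm_sq, inv_pow] using h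

/-- Comparison of the conserved quantity `|p|² + |q|²` at `s = 0` and as `s → +∞`. -/
theorem normSq_jost_zero {ε : ℝ} (hε : 0 ≤ ε) :
    Complex.normSq (jostFst ε 0) + Complex.normSq (jostSnd ε 0) =
      Real.exp (Real.pi * ε / 4) * (‖Complex.Gamma (1 + Complex.I * ε / 4)‖ ^ 2 *
      ‖Complex.Gamma (1 / 2 + Complex.I * ε / 4)‖ ^ 2 / Real.pi) := by
  set K := Real.exp (Real.pi * ε / 8) * (‖Complex.Gamma (1 + Complex.I * ε / 4)‖ *
      ‖Complex.Gamma (1 / 2 + Complex.I * ε / 4)‖ / √Real.pi) with hK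
  have h0 : Tendsto (fun s : ℝ => (s ^ 2)⁻¹) atTop (𝓝 0) :=
    (tendsto_pow_atTop two_ne_zero).inv_tendsto_atTop
  have h1 : Tendsto (fun s => ‖jostFst ε s‖) atTop (𝓝 K) := by
    have h2 := ((jostFst_sub_jostLead_isBigO ε).trans_tendsto h0).norm
    rw [norm_zero] at h2
    have h3 : Tendsto (fun s => ‖jostFst ε s‖ - K) atTop (𝓝 0) := by
      refine squeeze_zero_norm (fun s => ?_) h2
      rw [hK, ← norm_jostLead ε s]
      exact abs_norm_sub_norm_le _ _
    simpa using h3.add_const K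
  have h4 := (h1.pow 2).add ((normSq_jostSnd_isBigO ε).trans_tendsto h0)
  have h5 : (fun s => ‖jostFst ε s‖ ^ 2 + Complex.normSq (jostSnd ε s)) = fun _ =>
      Complex.normSq (jostFst ε 0) + Complex.normSq (jostSnd ε 0) := by
    ext s
    rw [← Complex.normSq_eq_norm_sq, (isSpinor_jost hε).normSq_add_normSq]
  rw [h5] at h4
  rw [tendsto_nhds_unique tendsto_const_nhds h4, hK, mul_pow, div_pow, mul_pow,
    Real.sq_sqrt Real.pi_pos.le, ← Real.exp_nat_mul, add_zero]
  congr 2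
  push_cast
  ring

theorem norm_Gamma_half_add_I_mul_sq (ε : ℝ) :
    ‖Complex.Gamma (1 / 2 + Complex.I * ε / 4)‖ ^ 2 * Real.cosh (Real.pi * ε / 4) = Real.pi := by
  have h := Complex.Gamma_mul_Gamma_one_sub (1 / 2 + Complex.I * ε / 4)
  have h1 : (1 : ℂ) - (1 / 2 + Complex.I * ε / 4) = conj (1 / 2 + Complex.I * ε / 4) := by
    simp [Complex.conj_ofNat]
    ring
  have h2 : Complex.sin (Real.pi * (1 / 2 + Complex.I * ε / 4)) =
      ((Real.cosh (Real.pi * ε / 4) : ℝ) : ℂ) := by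
    rw [show (Real.pi : ℂ) * (1 / 2 + Complex.I * ε / 4) =
      (Real.pi * ε / 4) * Complex.I + Real.pi / 2 by ring, Complex.sin_add_pi_div_two,
      Complex.cos_mul_I]
    push_cast
    rfl
  rw [h1, Complex.Gamma_conj, Complex.mul_conj, h2, Complex.normSq_eq_norm_sq] at h
  have h3 : ‖Complex.Gamma (1 / 2 + Complex.I * ε / 4)‖ ^ 2 =
      Real.pi / Real.cosh (Real.pi * ε / 4) := by exact_mod_cast h
  rw [h3, div_mul_cancel₀ _ (Real.cosh_pos _).ne']

/-! ### The tangent in terms of spinors -/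

/-- The tangent vector through the spinor `(P, Q)` with initial value `(n, 0)`: the columns of the
unitary matrix with columns `(P, Q) / n` and `(-conj Q, conj P) / n` are combined with the three
pairs of weights `(1, 0)`, `(1, 1)` and `(i, 1)`. -/
theorem IsSelfSimilarSolution.deriv_eq_of_isSpinor {ε : ℝ} (hε : 0 ≤ ε) {G : ℝ → E3}
    (hG : IsSelfSimilarSolution ε G) {P Q : ℝ → ℂ} (h : IsSpinor ε P Q) {n : ℝ} (hn : n ≠ 0)
    (hP : P 0 = n) (hQ : Q 0 = 0) (s : ℝ) :
    deriv G s 0 = (Complex.normSq (P s) - Complex.normSq (Q s)) / n ^ 2 ∧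
      deriv G s 1 = -2 * (P s * Q s).re / n ^ 2 ∧ deriv G s 2 = 2 * (P s * Q s).im / n ^ 2 := by
  have hnc : (n : ℂ) ≠ 0 := by exact_mod_cast hn
  have hq0 : conj (quadPhase 0) = 1 := by simp [quadPhase]
  refine ⟨?_, ?_, ?_⟩
  · rw [(hG.isTangentSystem hε 0).unique hε (h.isTangentSystem hε (1 / n ^ 2)) ?_ ?_ s]
    · ring
    · rw [hG.deriv_zero, hP, hQ]
      simp
      field_simp
    · rw [hG.deriv_deriv_zero, hG.normal_zero, hP, hQ]
      simp
  · rw [(hG.isTangentSystem hε 1).unique hε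
      ((h.linearCombination h.conj_swap 1 1).isTangentSystem hε (1 / (2 * n ^ 2))) ?_ ?_ s]
    · simp only [Complex.normSq_apply]
      simp
      field_simp
      ring
    · rw [hG.deriv_zero, hP, hQ]
      simp
    · rw [hG.deriv_deriv_zero, hG.normal_zero, hP, hQ, hq0]
      simp
      field_simp
  · rw [(hG.isTangentSystem hε 2).unique hε
      ((h.linearCombination h.conj_swap Complex.I 1).isTangentSystem hε (1 / (2 * n ^ 2))) ?_ ?_
        s]
    · simp only [Complex.normSq_apply]
      simp
      field_simp
      ring
    · rw [hG.deriv_zero, hP, hQ]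
      simp
    · rw [hG.deriv_deriv_zero, hG.normal_zero, hP, hQ, hq0]
      simp
      field_simp

/-- The constants of the asymptotic expansion, in terms of the moduli `r₁ = |Γ(1 + iε/4)|`,
`r₂ = |Γ(1/2 + iε/4)|` and of the conserved quantity `N`. -/
theorem exists_jost_constants {ε : ℝ} (hε : 0 ≤ ε) : ∃ r₁ r₂ N : ℝ, 0 < N ∧
    ‖Complex.Gamma (1 + Complex.I * ε / 4)‖ = r₁ ∧
    ‖Complex.Gamma (1 / 2 + Complex.I * ε / 4)‖ = r₂ ∧
    r₁ ^ 2 + ε / 4 * r₂ ^ 2 = N ∧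
    Real.exp (Real.pi * ε / 8) ^ 2 * (r₁ ^ 2 * r₂ ^ 2 / Real.pi) = N ∧
    r₁ ^ 2 = (1 + Real.exp (-(Real.pi * ε) / 2)) / 2 * N ∧
    ε / 4 * r₂ ^ 2 = (1 - Real.exp (-(Real.pi * ε) / 2)) / 2 * N ∧
    √ε * r₁ * r₂ = √(1 - Real.exp (-(Real.pi * ε))) * N := by
  set r₁ := ‖Complex.Gamma (1 + Complex.I * ε / 4)‖ with h1
  set r₂ := ‖Complex.Gamma (1 / 2 + Complex.I * ε / 4)‖ with h2
  have hpi := Real.pi_pos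
  have hr1 : 0 < r₁ := norm_pos_iff.2 (Complex.Gamma_ne_zero_of_re_pos (by simp))
  have hr2 : 0 < r₂ := norm_pos_iff.2 (Complex.Gamma_ne_zero_of_re_pos (by simp))
  have hN : Real.exp (Real.pi * ε / 8) ^ 2 * (r₁ ^ 2 * r₂ ^ 2 / Real.pi) =
      r₁ ^ 2 + ε / 4 * r₂ ^ 2 := by
    have h := normSq_jost_zero hε
    rw [normSq_jostFst_zero, normSq_jostSnd_zero hε, ← h1, ← h2] at h
    rw [← Real.exp_nat_mul, h]
    congr 2
    push_cast
    ring
  have hc := norm_Gamma_half_add_I_mul_sq ε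
  rw [← h2, Real.cosh_eq] at hc
  have he1 : Real.exp (-(Real.pi * ε / 4)) = (Real.exp (Real.pi * ε / 8) ^ 2)⁻¹ := by
    rw [← Real.exp_nat_mul, ← Real.exp_neg]
    congr 1
    push_cast
    ring
  have he2 : Real.exp (Real.pi * ε / 4) = Real.exp (Real.pi * ε / 8) ^ 2 := by
    rw [← Real.exp_nat_mul]
    congr 1
    push_cast
    ring
  have he3 : Real.exp (-(Real.pi * ε) / 2) = ((Real.exp (Real.pi * ε / 8) ^ 2)⁻¹) ^ 2 := by
    rw [← he1, ← Real.exp_nat_mul]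
    congr 1
    push_cast
    ring
  have he4 : Real.exp (-(Real.pi * ε)) = Real.exp (-(Real.pi * ε) / 2) ^ 2 := by
    rw [← Real.exp_nat_mul]
    congr 1
    push_cast
    ring
  rw [he1, he2] at hc
  have hx : 0 < Real.exp (Real.pi * ε / 8) := Real.exp_pos _
  set x := Real.exp (Real.pi * ε / 8)
  -- Dividing `N` by `r₁²` leaves `exp (π ε / 4) r₂² / π`, which the reflection formula evaluates.
  have hA : r₁ ^ 2 = (1 + Real.exp (-(Real.pi * ε) / 2)) / 2 * (r₁ ^ 2 + ε / 4 * r₂ ^ 2) := by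
    rw [← hN, he3]
    field_simp at hc ⊢
    linear_combination -hc
  have hB : ε / 4 * r₂ ^ 2 =
      (1 - Real.exp (-(Real.pi * ε) / 2)) / 2 * (r₁ ^ 2 + ε / 4 * r₂ ^ 2) := by
    linear_combination -hA
  have hNpos : 0 < r₁ ^ 2 + ε / 4 * r₂ ^ 2 := by positivity
  refine ⟨r₁, r₂, r₁ ^ 2 + ε / 4 * r₂ ^ 2, hNpos, rfl, rfl, rfl, hN, hA, hB, ?_⟩
  have hle : Real.exp (-(Real.pi * ε)) ≤ 1 := Real.exp_le_one_iff.2 (by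
    have := mul_nonneg hpi.le hε
    linarith)
  rw [← sq_eq_sq₀ (by positivity) (by positivity), mul_pow, mul_pow, mul_pow, Real.sq_sqrt hε,
    Real.sq_sqrt (by linarith), he4]
  linear_combination 4 * r₁ ^ 2 * hB +
    2 * (1 - Real.exp (-(Real.pi * ε) / 2)) * (r₁ ^ 2 + ε / 4 * r₂ ^ 2) * hA

theorem Gamma_one_add_eq (ε : ℝ) : Complex.Gamma (1 + Complex.I * ε / 4) =
    ‖Complex.Gamma (1 + Complex.I * ε / 4)‖ * Complex.exp (Complex.I * beta₁ ε) := by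
  rw [beta₁, mul_comm Complex.I ((Complex.arg _ : ℝ) : ℂ), Complex.norm_mul_exp_arg_mul_I]

theorem Gamma_half_add_eq (ε : ℝ) : Complex.Gamma (1 / 2 + Complex.I * ε / 4) =
    ‖Complex.Gamma (1 / 2 + Complex.I * ε / 4)‖ * (zeta8 * Complex.exp (Complex.I * beta₂ ε)) := by
  rw [beta₂, zeta8, ← Complex.exp_add,
    show Complex.I * (Real.pi / 4) + Complex.I *
      (((Complex.Gamma (1 / 2 + Complex.I * ε / 4)).arg - Real.pi / 4 : ℝ) : ℂ) =
      ((Complex.Gamma (1 / 2 + Complex.I * ε / 4)).arg : ℂ) * Complex.I by push_cast; ring,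
    Complex.norm_mul_exp_arg_mul_I]

theorem conj_exp_I_mul (t : ℝ) :
    conj (Complex.exp (Complex.I * t)) = Complex.exp (-(Complex.I * t)) := by
  rw [← Complex.exp_conj]
  simp

theorem exp_I_mul_mul_conj (t : ℝ) :
    Complex.exp (Complex.I * t) * conj (Complex.exp (Complex.I * t)) = 1 := by
  rw [conj_exp_I_mul, ← Complex.exp_add]
  simp

/-- The oscillation at order `1 / s` is governed by this product. -/
theorem jostLead_mul_jostSndLead (ε s : ℝ) {r₁ r₂ N : ℝ}
    (h1 : ‖Complex.Gamma (1 + Complex.I * ε / 4)‖ = r₁)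
    (h2 : ‖Complex.Gamma (1 / 2 + Complex.I * ε / 4)‖ = r₂)
    (hN : Real.exp (Real.pi * ε / 8) ^ 2 * (r₁ ^ 2 * r₂ ^ 2 / Real.pi) = N) :
    jostLead ε s * jostSndLead ε s = Complex.I * √ε / s * N *
      (conj (Complex.exp (Complex.I * phaseΩ ε s)) *
        Complex.exp (Complex.I * beta₁ ε) ^ 2 * Complex.exp (Complex.I * beta₂ ε) ^ 2) := by
  have hNc : (Real.exp (Real.pi * ε / 8) : ℂ) ^ 2 * (r₁ ^ 2 * r₂ ^ 2 / √Real.pi ^ 2) = N := by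
    rw [← hN, ← Complex.ofReal_pow √Real.pi, Real.sq_sqrt Real.pi_pos.le]
    push_cast
    rfl
  have hΩ : conj (Complex.exp (Complex.I * phaseΩ ε s)) = conj (quadPhase s) *
      Complex.exp (-(Complex.I * (ε / 2 * Real.log (s / 2)))) ^ 2 := by
    rw [conj_exp_I_mul, conj_quadPhase, ← Complex.exp_nat_mul, ← Complex.exp_add, phaseΩ]
    congr 1
    push_cast
    ring
  have hz : zeta8 ^ 4 = -1 := by
    linear_combination (zeta8 * zeta8 + Complex.I) * zeta8_sq + Complex.I_mul_I
  rw [hΩ, ← hNc, jostSndLead, jostLead, Gamma_one_add_eq, Gamma_half_add_eq, h1, h2]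
  generalize Complex.exp (-(Complex.I * (ε / 2 * Real.log (s / 2)))) = w
  generalize Complex.exp (Complex.I * beta₁ ε) = b₁
  generalize Complex.exp (Complex.I * beta₂ ε) = b₂
  linear_combination (-(Complex.I * √ε / s) * conj (quadPhase s) *
    (Real.exp (Real.pi * ε / 8) : ℂ) ^ 2 * r₁ ^ 2 * r₂ ^ 2 / (√Real.pi : ℂ) ^ 2 * b₁ ^ 2 * b₂ ^ 2 *
      w ^ 2) * hz

theorem isBigO_re {f : ℝ → ℂ} {g : ℝ → ℝ} (h : f =O[atTop] g) :
    (fun s => (f s).re) =O[atTop] g :=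
  (IsBigO.of_bound 1 (Eventually.of_forall fun s => by
    simpa using Complex.abs_re_le_norm (f s))).trans h

theorem isBigO_conj {f : ℝ → ℂ} {g : ℝ → ℝ} (h : f =O[atTop] g) :
    (fun s => conj (f s)) =O[atTop] g :=
  (IsBigO.of_bound 1 (Eventually.of_forall fun s => by simp)).trans h

theorem isBigO_ofReal {f g : ℝ → ℝ} (h : f =O[atTop] g) :
    (fun s => (f s : ℂ)) =O[atTop] g :=
  (IsBigO.of_bound 1 (Eventually.of_forall fun s => by simp)).trans h

namespace IsSelfSimilarSolution

variable {ε : ℝ} {G : ℝ → E3}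

/-- The tangent in terms of the explicit spinor. -/
theorem deriv_eq_jost (hε : 0 ≤ ε) (hG : IsSelfSimilarSolution ε G) {N : ℝ} (hN : 0 < N)
    (h0 : Complex.normSq (jostFst ε 0) + Complex.normSq (jostSnd ε 0) = N) (s : ℝ) :
    deriv G s 0 = ((Complex.normSq (jostFst ε 0) - Complex.normSq (jostSnd ε 0)) *
      (N - 2 * Complex.normSq (jostSnd ε s)) + 4 * (conj (jostFst ε 0) * conj (jostSnd ε 0) *
        (jostFst ε s * jostSnd ε s)).re) / N ^ 2 ∧
    (deriv G s 1 : ℂ) + Complex.I * (deriv G s 2 : ℂ) =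
      -2 / N ^ 2 * conj (conj (jostFst ε 0) ^ 2 * (jostFst ε s * jostSnd ε s) -
        jostSnd ε 0 ^ 2 * conj (jostFst ε s * jostSnd ε s) +
        conj (jostFst ε 0) * jostSnd ε 0 * (2 * Complex.normSq (jostSnd ε s) - N : ℝ)) := by
  have h := isSpinor_jost hε
  have hn : Complex.normSq (jostFst ε s) = N - Complex.normSq (jostSnd ε s) := by
    rw [← h0, ← h.normSq_add_normSq s]
    ring
  -- The combination of the two known solutions whose value at `0` is `(N, 0)`.
  have hS := h.linearCombination h.conj_swap (conj (jostFst ε 0)) (-jostSnd ε 0)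
  obtain ⟨e0, e1, e2⟩ := hG.deriv_eq_of_isSpinor hε hS hN.ne'
    (by
      rw [← h0]
      push_cast
      rw [← Complex.mul_conj, ← Complex.mul_conj]
      ring)
    (by ring) s
  have hn2 : (Complex.normSq (jostFst ε s) : ℂ) = N - Complex.normSq (jostSnd ε s) := by
    rw [hn]; push_cast; rfl
  constructor
  · rw [e0]
    congr 1
    rw [show N - 2 * Complex.normSq (jostSnd ε s) =
      Complex.normSq (jostFst ε s) - Complex.normSq (jostSnd ε s) by rw [hn]; ring]
    simp only [Complex.normSq_apply]
    simp
    ring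
  · rw [e1, e2]
    have hc : ∀ w : ℂ, ((-2 * w.re / N ^ 2 : ℝ) : ℂ) + Complex.I * ((2 * w.im / N ^ 2 : ℝ) : ℂ) =
        -2 / N ^ 2 * conj w := fun w => by
      have hw : conj w = w.re - Complex.I * w.im := by
        apply Complex.ext <;> simp
      rw [hw]
      push_cast
      ring
    rw [hc]
    congr 2
    have e3 := Complex.mul_conj (jostFst ε s)
    have e4 := Complex.mul_conj (jostSnd ε s)
    rw [hn2] at e3
    rw [map_mul]
    push_cast
    linear_combination (-(conj (jostFst ε 0) * jostSnd ε 0)) * (e3 - e4)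

end IsSelfSimilarSolution

/-! ### Asymptotics and limits of the tangent -/

/-- The expansion of `G₂' + i G₃'` up to terms of order `s⁻²`. -/
noncomputable def tangentLead (ε s : ℝ) : ℂ :=
  (√(1 - Real.exp (-(Real.pi * ε))) : ℝ) * Complex.exp (Complex.I * (beta₁ ε - beta₂ ε)) +
    ((√ε / s : ℝ) : ℂ) *
      (((1 - Real.exp (-(Real.pi * ε) / 2) : ℝ) : ℂ) *
          Complex.exp (-(Complex.I * phaseΩ ε s) + 2 * Complex.I * beta₁ ε) -
        ((1 + Real.exp (-(Real.pi * ε) / 2) : ℝ) : ℂ) *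
          Complex.exp (Complex.I * phaseΩ ε s - 2 * Complex.I * beta₂ ε))

namespace IsSelfSimilarSolution

variable {ε : ℝ} {G : ℝ → E3}

theorem deriv_zero_asymptotics (hε : 0 ≤ ε) (hG : IsSelfSimilarSolution ε G) :
    (fun s : ℝ => deriv G s 0 -
        (Real.exp (-(Real.pi * ε) / 2) +
          2 * √(ε * (1 - Real.exp (-(Real.pi * ε)))) / s *
            Real.cos (phaseΩ ε s - beta₁ ε - beta₂ ε)))
      =O[atTop] fun s : ℝ => (s ^ 2)⁻¹ := by
  obtain ⟨r₁, r₂, N, hN, h1, h2, h3, h4, h5, h6, h7⟩ := exists_jost_constants hε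
  have n1 := normSq_jostFst_zero ε
  have n2 := normSq_jostSnd_zero hε
  rw [h1] at n1
  rw [h2] at n2
  have hlead : ∀ s, (conj (jostFst ε 0) * conj (jostSnd ε 0) *
      (jostLead ε s * jostSndLead ε s)).re =
        √ε * √(1 - Real.exp (-(Real.pi * ε))) * N ^ 2 / 2 / s *
          Real.cos (phaseΩ ε s - beta₁ ε - beta₂ ε) := by
    intro s
    have hb1 := exp_I_mul_mul_conj (beta₁ ε)
    have hb2 := exp_I_mul_mul_conj (beta₂ ε)
    have hcos : Real.cos (phaseΩ ε s - beta₁ ε - beta₂ ε) =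
        (conj (Complex.exp (Complex.I * phaseΩ ε s)) * Complex.exp (Complex.I * beta₁ ε) *
          Complex.exp (Complex.I * beta₂ ε)).re := by
      rw [conj_exp_I_mul, ← Complex.exp_add, ← Complex.exp_add,
        show -(Complex.I * (phaseΩ ε s : ℂ)) + Complex.I * beta₁ ε + Complex.I * beta₂ ε =
          ((-(phaseΩ ε s - beta₁ ε - beta₂ ε) : ℝ) : ℂ) * Complex.I by push_cast; ring,
        Complex.exp_ofReal_mul_I_re, Real.cos_neg]
    rw [hcos, ← Complex.re_ofReal_mul]
    congr 1
    rw [jostLead_mul_jostSndLead ε s h1 h2 h4, jostFst_zero, jostSnd_zero, Gamma_one_add_eq,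
      Gamma_half_add_eq, h1, h2]
    simp only [map_mul, map_div₀, Complex.conj_ofReal, map_ofNat]
    have h7c : (√ε : ℂ) * r₁ * r₂ = √(1 - Real.exp (-(Real.pi * ε))) * N := by exact_mod_cast h7
    have hz := conj_zeta8_sq
    generalize Complex.exp (Complex.I * beta₁ ε) = b₁ at *
    generalize Complex.exp (Complex.I * beta₂ ε) = b₂ at *
    generalize conj (Complex.exp (Complex.I * phaseΩ ε s)) = w at *
    push_cast
    calc _ = (conj zeta8 * conj zeta8) * (Complex.I * √ε / 2 * (√ε * r₁ * r₂) * N / s) * w *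
          (b₁ * conj b₁) * (b₂ * conj b₂) * b₁ * b₂ := by ring
      _ = -(Complex.I * Complex.I) * (√ε / 2 * (√(1 - Real.exp (-(Real.pi * ε))) * N) * N / s) *
          w * b₁ * b₂ := by rw [hz, hb1, hb2, h7c]; ring
      _ = _ := by rw [Complex.I_mul_I]; ring
  have hO := ((normSq_jostSnd_isBigO ε).const_mul_left
      (-2 * (Complex.normSq (jostFst ε 0) - Complex.normSq (jostSnd ε 0)) / N ^ 2)).add
    ((isBigO_re ((jostFst_mul_jostSnd_isBigO ε).const_mul_left
      (conj (jostFst ε 0) * conj (jostSnd ε 0)))).const_mul_left (4 / N ^ 2))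
  refine hO.congr_left fun s => ?_
  rw [(hG.deriv_eq_jost hε hN (by rw [n1, n2, h3]) s).1,
    mul_sub (conj (jostFst ε 0) * conj (jostSnd ε 0)), Complex.sub_re, hlead, n1, n2,
    h5, h6, Real.sqrt_mul hε]
  field_simp
  ring

theorem deriv_one_add_I_mul_deriv_two_asymptotics (hε : 0 ≤ ε) (hG : IsSelfSimilarSolution ε G) :
    (fun s : ℝ => ((deriv G s 1 : ℝ) : ℂ) + Complex.I * ((deriv G s 2 : ℝ) : ℂ) -
        tangentLead ε s)
      =O[atTop] fun s : ℝ => (s ^ 2)⁻¹ := by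
  obtain ⟨r₁, r₂, N, hN, h1, h2, h3, h4, h5, h6, h7⟩ := exists_jost_constants hε
  have hNc : (N : ℂ) ≠ 0 := by exact_mod_cast hN.ne'
  have n1 := normSq_jostFst_zero ε
  have n2 := normSq_jostSnd_zero hε
  rw [h1] at n1
  rw [h2] at n2
  have hk : (√ε : ℂ) * √ε = ε := by
    rw [← Complex.ofReal_mul, Real.mul_self_sqrt hε]
  have h5c : (r₁ : ℂ) ^ 2 = (1 + Real.exp (-(Real.pi * ε) / 2) : ℝ) / 2 * N := by
    exact_mod_cast h5
  have h6c : (ε : ℂ) / 4 * r₂ ^ 2 = (1 - Real.exp (-(Real.pi * ε) / 2) : ℝ) / 2 * N := by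
    exact_mod_cast h6
  have h7c : (√ε : ℂ) * r₁ * r₂ = √(1 - Real.exp (-(Real.pi * ε))) * N := by exact_mod_cast h7
  have hlead : ∀ s, conj (jostFst ε 0) ^ 2 * (jostLead ε s * jostSndLead ε s) -
      jostSnd ε 0 ^ 2 * conj (jostLead ε s * jostSndLead ε s) -
        conj (jostFst ε 0) * jostSnd ε 0 * N = -(N ^ 2 / 2) * conj (tangentLead ε s) := by
    intro s
    have e1 : Complex.exp (Complex.I * (beta₁ ε - beta₂ ε)) =
        Complex.exp (Complex.I * beta₁ ε) * conj (Complex.exp (Complex.I * beta₂ ε)) := by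
      rw [conj_exp_I_mul, ← Complex.exp_add]
      ring_nf
    have e2 : Complex.exp (-(Complex.I * phaseΩ ε s) + 2 * Complex.I * beta₁ ε) =
        conj (Complex.exp (Complex.I * phaseΩ ε s)) * Complex.exp (Complex.I * beta₁ ε) ^ 2 := by
      rw [conj_exp_I_mul, ← Complex.exp_nat_mul, ← Complex.exp_add]
      push_cast
      ring_nf
    have e3 : Complex.exp (Complex.I * phaseΩ ε s - 2 * Complex.I * beta₂ ε) =
        Complex.exp (Complex.I * phaseΩ ε s) *
          conj (Complex.exp (Complex.I * beta₂ ε)) ^ 2 := by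
      rw [conj_exp_I_mul, ← Complex.exp_nat_mul, ← Complex.exp_add]
      push_cast
      ring_nf
    have hb1 := exp_I_mul_mul_conj (beta₁ ε)
    have hb2 := exp_I_mul_mul_conj (beta₂ ε)
    rw [tangentLead, e1, e2, e3, jostLead_mul_jostSndLead ε s h1 h2 h4, jostFst_zero, jostSnd_zero,
      Gamma_one_add_eq, Gamma_half_add_eq, h1, h2]
    simp only [map_mul, map_div₀, map_add, map_sub, map_pow, Complex.conj_ofReal, Complex.conj_conj,
      Complex.conj_I]
    have hz := conj_zeta8_sq
    have hz1 := zeta8_sq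
    have hz2 := zeta8_mul_conj
    generalize Complex.exp (Complex.I * beta₁ ε) = b₁ at *
    generalize Complex.exp (Complex.I * beta₂ ε) = b₂ at *
    generalize Complex.exp (Complex.I * phaseΩ ε s) = w at *
    rw [Complex.ofReal_div]
    generalize ((1 + Real.exp (-(Real.pi * ε) / 2) : ℝ) : ℂ) = A at *
    generalize ((1 - Real.exp (-(Real.pi * ε) / 2) : ℝ) : ℂ) = B at *
    calc _ = (conj zeta8 * conj zeta8) * (r₁ : ℂ) ^ 2 * (Complex.I * √ε / s * N) * conj w *
            (b₁ * conj b₁) ^ 2 * b₂ ^ 2 +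
          (zeta8 * zeta8) * ((√ε * √ε : ℂ) / 4 * r₂ ^ 2) * (Complex.I * √ε / s * N) * w *
            (b₂ * conj b₂) ^ 2 * conj b₁ ^ 2 -
          (zeta8 * conj zeta8) * (√ε * r₁ * r₂) / 2 * N * conj b₁ * b₂ := by ring
      _ = -(Complex.I * Complex.I) * (A / 2 * N) * (√ε / s * N) * conj w * b₂ ^ 2 +
          (Complex.I * Complex.I) * (B / 2 * N) * (√ε / s * N) * w * conj b₁ ^ 2 -
          (√(1 - Real.exp (-(Real.pi * ε))) * N) / 2 * N * conj b₁ * b₂ := by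
            rw [hz, hz1, hz2, hb1, hb2, hk, h5c, h6c, h7c]; ring
      _ = _ := by rw [Complex.I_mul_I]; ring
  have hW := jostFst_mul_jostSnd_isBigO ε
  have hO := (isBigO_conj (((hW.const_mul_left (conj (jostFst ε 0) ^ 2)).sub
    ((isBigO_conj hW).const_mul_left (jostSnd ε 0 ^ 2))).add
    ((isBigO_ofReal (normSq_jostSnd_isBigO ε)).const_mul_left
      (2 * (conj (jostFst ε 0) * jostSnd ε 0))))).const_mul_left (-2 / (N : ℂ) ^ 2)
  refine hO.congr_left fun s => ?_
  have hl := congrArg conj (hlead s)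
  rw [map_mul conj (-((N : ℂ) ^ 2 / 2)), Complex.conj_conj] at hl
  rw [(hG.deriv_eq_jost hε hN (by rw [n1, n2, h3]) s).2]
  simp only [map_sub, map_add, map_mul, map_neg, map_div₀, map_pow, Complex.conj_conj,
    Complex.conj_ofReal, map_ofNat, Complex.ofReal_sub, Complex.ofReal_mul,
    Complex.ofReal_ofNat] at hl ⊢
  have hN2 : (-2 / (N : ℂ) ^ 2) * (-((N : ℂ) ^ 2 / 2)) = 1 := by
    field_simp
  linear_combination (2 / (N : ℂ) ^ 2) * hl - tangentLead ε s * hN2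

end IsSelfSimilarSolution

theorem tendsto_of_sub_isBigO {E : Type*} [NormedAddCommGroup E] {f g : ℝ → E} {c : E}
    (hO : (fun s => f s - (c + g s)) =O[atTop] fun s : ℝ => (s ^ 2)⁻¹)
    (hg : g =O[atTop] fun s : ℝ => s⁻¹) : Tendsto f atTop (𝓝 c) := by
  have h1 := ((hO.trans inv_sq_isBigO_inv).add hg).trans_tendsto tendsto_inv_atTop_zero
  have h2 := h1.add_const c
  rw [zero_add] at h2
  refine h2.congr fun s => ?_
  abel

theorem norm_exp_I_mul_ofReal (t : ℝ) : ‖Complex.exp (Complex.I * t)‖ = 1 := by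
  rw [mul_comm, Complex.norm_exp_ofReal_mul_I]

namespace IsSelfSimilarSolution

variable {ε : ℝ} {G : ℝ → E3}

theorem tendsto_deriv_zero (hε : 0 ≤ ε) (hG : IsSelfSimilarSolution ε G) :
    Tendsto (fun s => deriv G s 0) atTop (𝓝 (Real.exp (-(Real.pi * ε) / 2))) := by
  refine tendsto_of_sub_isBigO (hG.deriv_zero_asymptotics hε)
    (IsBigO.of_bound (2 * √(ε * (1 - Real.exp (-(Real.pi * ε)))))
      (Eventually.of_forall fun s => ?_))
  rw [div_eq_mul_inv, mul_assoc, norm_mul, norm_mul (s⁻¹), Real.norm_of_nonneg (by positivity)]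
  exact mul_le_mul_of_nonneg_left (mul_le_of_le_one_right (norm_nonneg _)
    (Real.abs_cos_le_one _)) (by positivity)

theorem tendsto_deriv_one_add_I_mul_deriv_two (hε : 0 ≤ ε) (hG : IsSelfSimilarSolution ε G) :
    Tendsto (fun s : ℝ => ((deriv G s 1 : ℝ) : ℂ) + Complex.I * ((deriv G s 2 : ℝ) : ℂ)) atTop
      (𝓝 ((√(1 - Real.exp (-(Real.pi * ε))) : ℝ) *
        Complex.exp (Complex.I * (beta₁ ε - beta₂ ε)))) := by
  refine tendsto_of_sub_isBigO (hG.deriv_one_add_I_mul_deriv_two_asymptotics hε)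
    (IsBigO.of_bound (√ε * (|1 - Real.exp (-(Real.pi * ε) / 2)| +
      |1 + Real.exp (-(Real.pi * ε) / 2)|)) (Eventually.of_forall fun s => ?_))
  have e1 : -(Complex.I * phaseΩ ε s) + 2 * Complex.I * beta₁ ε =
      Complex.I * ((-phaseΩ ε s + 2 * beta₁ ε : ℝ) : ℂ) := by push_cast; ring
  have e2 : Complex.I * phaseΩ ε s - 2 * Complex.I * beta₂ ε =
      Complex.I * ((phaseΩ ε s - 2 * beta₂ ε : ℝ) : ℂ) := by push_cast; ring
  rw [e1, e2, norm_mul, Complex.norm_real, div_eq_mul_inv, norm_mul,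
    Real.norm_of_nonneg (Real.sqrt_nonneg _), mul_assoc, mul_assoc, mul_comm ‖s⁻¹‖]
  refine mul_le_mul_of_nonneg_left (mul_le_mul_of_nonneg_right ((norm_sub_le _ _).trans_eq ?_)
    (norm_nonneg _)) (Real.sqrt_nonneg _)
  rw [norm_mul, norm_mul, norm_exp_I_mul_ofReal, norm_exp_I_mul_ofReal, Complex.norm_real,
    Complex.norm_real, mul_one, mul_one, Real.norm_eq_abs, Real.norm_eq_abs]

theorem deriv_zero_neg (hε : 0 ≤ ε) (hG : IsSelfSimilarSolution ε G) (s : ℝ) :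
    deriv G (-s) 0 = deriv G s 0 :=
  (hG.isTangentSystem hε 0).even_of_snd_eq_zero hε (by
    rw [hG.deriv_deriv_zero, hG.normal_zero]; simp) s

theorem deriv_one_neg (hε : 0 ≤ ε) (hG : IsSelfSimilarSolution ε G) (s : ℝ) :
    deriv G (-s) 1 = -deriv G s 1 :=
  (hG.isTangentSystem hε 1).odd_of_fst_eq_zero hε (by rw [hG.deriv_zero]; simp) s

theorem deriv_two_neg (hε : 0 ≤ ε) (hG : IsSelfSimilarSolution ε G) (s : ℝ) :
    deriv G (-s) 2 = -deriv G s 2 :=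
  (hG.isTangentSystem hε 2).odd_of_fst_eq_zero hε (by rw [hG.deriv_zero]; simp) s

theorem tendsto_deriv_one (hε : 0 ≤ ε) (hG : IsSelfSimilarSolution ε G) :
    Tendsto (fun s => deriv G s 1) atTop
      (𝓝 (√(1 - Real.exp (-(Real.pi * ε))) * Real.cos (beta₁ ε - beta₂ ε))) := by
  have h := (Complex.continuous_re.tendsto _).comp (hG.tendsto_deriv_one_add_I_mul_deriv_two hε)
  rw [← Complex.ofReal_sub, mul_comm Complex.I, Complex.re_ofReal_mul,
    Complex.exp_ofReal_mul_I_re] at h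
  refine h.congr fun s => ?_
  simp

theorem tendsto_deriv_two (hε : 0 ≤ ε) (hG : IsSelfSimilarSolution ε G) :
    Tendsto (fun s => deriv G s 2) atTop
      (𝓝 (√(1 - Real.exp (-(Real.pi * ε))) * Real.sin (beta₁ ε - beta₂ ε))) := by
  have h := (Complex.continuous_im.tendsto _).comp (hG.tendsto_deriv_one_add_I_mul_deriv_two hε)
  rw [← Complex.ofReal_sub, mul_comm Complex.I, Complex.im_ofReal_mul,
    Complex.exp_ofReal_mul_I_im] at h
  refine h.congr fun s => ?_
  simp

end IsSelfSimilarSolution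

theorem tendsto_euclidean_three {l : Filter ℝ} {f : ℝ → E3} {a b c : ℝ}
    (h0 : Tendsto (fun s => f s 0) l (𝓝 a)) (h1 : Tendsto (fun s => f s 1) l (𝓝 b))
    (h2 : Tendsto (fun s => f s 2) l (𝓝 c)) : Tendsto f l (𝓝 !₂[a, b, c]) := by
  have h : Tendsto (fun s => (f s).ofLp) l (𝓝 ![a, b, c]) := by
    rw [tendsto_pi_nhds]
    intro i
    match i with
    | 0 => exact h0
    | 1 => exact h1
    | 2 => exact h2
  exact ((PiLp.continuous_toLp 2 _).tendsto _).comp h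

theorem mainTheorem5 (ε : ℝ) (hε : 0 ≤ ε) (G : ℝ → E3) (hG : IsSelfSimilarSolution ε G) :
    ((fun s : ℝ => deriv G s 0 -
        (Real.exp (-(Real.pi * ε) / 2) +
          2 * √(ε * (1 - Real.exp (-(Real.pi * ε)))) / s *
            Real.cos (phaseΩ ε s - beta₁ ε - beta₂ ε)))
      =O[atTop] fun s : ℝ => (s ^ 2)⁻¹) ∧
    (∀ ν : ℝ, ν = 1 ∨ ν = -1 →
      (fun s : ℝ => ((deriv G s 1 : ℝ) : ℂ) + ν * Complex.I * ((deriv G s 2 : ℝ) : ℂ) -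
        ((√(1 - Real.exp (-(Real.pi * ε))) : ℝ) *
            Complex.exp (ν * Complex.I * (beta₁ ε - beta₂ ε)) +
          ((√ε / s : ℝ) : ℂ) *
            (((1 - Real.exp (-(Real.pi * ε) / 2) : ℝ) : ℂ) *
                Complex.exp (-(ν * Complex.I * phaseΩ ε s) + 2 * ν * Complex.I * beta₁ ε) -
              ((1 + Real.exp (-(Real.pi * ε) / 2) : ℝ) : ℂ) *
                Complex.exp (ν * Complex.I * phaseΩ ε s - 2 * ν * Complex.I * beta₂ ε))))
      =O[atTop] fun s : ℝ => (s ^ 2)⁻¹) ∧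
    ∃ Tplus Tminus : E3,
      Tendsto (deriv G) atTop (𝓝 Tplus) ∧
      Tendsto (deriv G) atBot (𝓝 Tminus) ∧
      Tplus = !₂[Real.exp (-(Real.pi * ε) / 2),
        √(1 - Real.exp (-(Real.pi * ε))) * Real.cos (beta₁ ε - beta₂ ε),
        √(1 - Real.exp (-(Real.pi * ε))) * Real.sin (beta₁ ε - beta₂ ε)] ∧
      Tminus = !₂[Real.exp (-(Real.pi * ε) / 2),
        -(√(1 - Real.exp (-(Real.pi * ε))) * Real.cos (beta₁ ε - beta₂ ε)),
        -(√(1 - Real.exp (-(Real.pi * ε))) * Real.sin (beta₁ ε - beta₂ ε))] ∧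
      inner ℝ Tplus Tminus = 2 * Real.exp (-(Real.pi * ε)) - 1 := by
  have hre := hG.deriv_one_add_I_mul_deriv_two_asymptotics hε
  refine ⟨hG.deriv_zero_asymptotics hε, ?_, ?_⟩
  · rintro ν (rfl | rfl)
    · simpa [tangentLead] using hre
    -- The components are real, so the case `ν = -1` is the complex conjugate of `ν = 1`.
    · refine (isBigO_conj hre).congr_left fun s => ?_
      simp only [tangentLead, map_sub, map_add, map_mul, Complex.conj_ofReal, Complex.conj_I,
        ← Complex.exp_conj, map_neg, map_ofNat]
      push_cast
      ring_nf
  · have l0 := hG.tendsto_deriv_zero hε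
    have l1 := hG.tendsto_deriv_one hε
    have l2 := hG.tendsto_deriv_two hε
    refine ⟨_, _, tendsto_euclidean_three l0 l1 l2, tendsto_euclidean_three
      ((l0.comp tendsto_neg_atBot_atTop).congr fun s => hG.deriv_zero_neg hε s)
      ((l1.neg.comp tendsto_neg_atBot_atTop).congr fun s => ?_)
      ((l2.neg.comp tendsto_neg_atBot_atTop).congr fun s => ?_), rfl, rfl, ?_⟩
    · simp [hG.deriv_one_neg hε s]
    · simp [hG.deriv_two_neg hε s]
    · have hle : Real.exp (-(Real.pi * ε)) ≤ 1 := Real.exp_le_one_iff.2 (by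
        have := mul_nonneg Real.pi_pos.le hε
        linarith)
      have hsq := Real.sq_sqrt (sub_nonneg.2 hle)
      have he : Real.exp (-(Real.pi * ε) / 2) ^ 2 = Real.exp (-(Real.pi * ε)) := by
        rw [← Real.exp_nat_mul]
        congr 1
        push_cast
        ring
      have hcs := Real.sin_sq_add_cos_sq (beta₁ ε - beta₂ ε)
      simp only [PiLp.inner_apply, Fin.sum_univ_three]
      simp
      linear_combination he - √(1 - Real.exp (-(Real.pi * ε))) ^ 2 * hcs - hsq
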